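/- Let $0<\varepsilon<\pi/2$ and $\sigma,m,\mu,\nu,\rho_1,\rho_2,\rho_3>0$, $\zeta_0\in\mathbb R$, and let $N\ge 2$ be the space dimension. For constants $\gamma_1,\gamma_3$ with $\rho_1\le\gamma_1\le\rho_2$ and $0<\gamma_3\le\rho_3$ put $\alpha=\gamma_1^{-1}\mu$ and $\beta=\gamma_1^{-1}(\nu-\mu)$. Let $\Sigma_\varepsilon=\{z\in\mathbb C\setminus\{0\}:|\arg z|\le\pi-\varepsilon\}$. The parameter $\zeta$ is of one of the following kinds, and for $\lambda_0>0$ the region $\Gamma_{\varepsilon,\lambda_0,\zeta}\subset\mathbb C$ is defined accordingly: * (C1) $\zeta=\gamma_1^{-1}\gamma_3\lambda^{-1}$ (a function of $\lambda$), and $\Gamma_{\varepsilon,\lambda_0,\zeta}=\{\lambda\in\Sigma_\varepsilon:|\lambda|\ge\lambda_0,\ (\operatorname{Re}\lambda+\rho_3/\nu+\varepsilon)^2+(\operatorname{Im}\lambda)^2\ge(\rho_3/\nu+\varepsilon)^2\}$; * (C2) $\zeta\in\Sigma_\varepsilon$ is a constant with $\operatorname{Re}\zeta<0$, $|\zeta|\le\zeta_0$,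 and $\Gamma_{\varepsilon,\lambda_0,\zeta}=\{\lambda:\operatorname{Re}\lambda\ge|\operatorname{Re}\zeta/\operatorname{Im}\zeta|\,|\operatorname{Im}\lambda|,\ \operatorname{Re}\lambda\ge\lambda_0\}$; * (C3) $\zeta$ is a constant with $\operatorname{Re}\zeta\ge0$, $|\zeta|\le\zeta_0$, and $\Gamma_{\varepsilon,\lambda_0,\zeta}=\{\lambda:\operatorname{Re}\lambda\ge\lambda_0\}$. For $\xi'\in\mathbb R^{N-1}$ let, with principal square roots, $$A=\sqrt{(2\alpha+\beta+\zeta)^{-1}\lambda+|\xi'|^2},\qquad B=\sqrt{\alpha^{-1}\lambda+|\xi'|^2},$$ and let $\mathbb L=[L_{ij}]_{2\times2}$ be the Lopatinski matrix $$L_{11}=\frac{\alpha A(B^2-|\xi'|^2)}{AB-|\xi'|^2},\quad L_{12}=\frac{\alpha|\xi'|^2(2AB-|\xi'|^2-B^2)}{AB-|\xi'|^2},$$ $$L_{21}=\frac{2\alpha A(B-A)-(\beta+\zeta)(A^2-|\xi'|^2)}{AB-|\xi'|^2},\quad L_{22}=\frac{(2\alpha+\beta+\zeta)B(A^2-|\xi'|^2)}{AB-|\xi'|^2}.$$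 Set $N(A,B)=\lambda\det\mathbb L+\sigma L_{11}(m+|\xi'|^2)$ and $\tau=\operatorname{Im}\lambda$. Then there are $\lambda_0\ge1$ and $c>0$, depending only on $\sigma,m,\varepsilon,\mu,\nu,\zeta_0,\rho_1,\rho_2,\rho_3$, and for every multi-index $\kappa'\in\mathbb N_0^{N-1}$ a constant $C_{\kappa'}>0$, depending only on these quantities and on $\kappa'$ (hence on $N$), such that for all $\gamma_1,\gamma_3,\zeta$ as above, all $\lambda\in\Gamma_{\varepsilon,\lambda_0,\zeta}$, all $\xi'\in\mathbb R^{N-1}\setminus\{0\}$ and $\ell=0,1$: $$|N(A,B)|\ge c\,(|\lambda|+|\xi'|)(|\lambda|^{1/2}+|\xi'|)^2,$$ the function $(\lambda,\xi')\mapsto N(A,B)^{-1}$ is smooth (in the real sense) near $(\lambda,\xi')$, and $$\big|\partial_{\xi'}^{\kappa'}(\tau\partial_\tau)^\ell\big(N(A,B)^{-1}\big)\big|\le C_{\kappa'}(|\lambda|+|\xi'|)^{-1}(|\lambda|^{1/2}+|\xi'|)^{-2-|\kappa'|}.$$ -/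

import Mathlib

open scoped ContDiff

noncomputable section

/-! Throughout, `lam` is the resolvent parameter `λ`, `ξ` is the tangential frequency `ξ'`, and
`α = μ / γ₁`, `β = (ν - μ) / γ₁`. -/

/-- The sector `Σ_ε = {z ≠ 0 : |arg z| ≤ π - ε}`. -/
def sectorSet (ε : ℝ) : Set ℂ := {z | z ≠ 0 ∧ |z.arg| ≤ Real.pi - ε}

/-- The truncated sector `Σ_{ε,λ₀} = {z ∈ Σ_ε : |z| ≥ λ₀}`. -/
def truncSector (ε lam₀ : ℝ) : Set ℂ := {z | z ∈ sectorSet ε ∧ lam₀ ≤ ‖z‖}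

/-- The region `Λ_{ε,λ₀}`: the truncated sector minus an open disc that touches the origin
from the left. -/
def regionLambda (ν ρ₃ ε lam₀ : ℝ) : Set ℂ :=
  {z | z ∈ truncSector ε lam₀ ∧
    (ρ₃ / ν + ε) ^ 2 ≤ (z.re + ρ₃ / ν + ε) ^ 2 + z.im ^ 2}

/-- The two kinds of parameter `ζ`: the one that depends on `λ` (case C1), and a fixed complex
number (cases C2 and C3). -/
inductive ZetaParam where
  | recip : ZetaParam
  | const (ζ : ℂ) : ZetaParam

namespace ZetaParam

/-- The value of `ζ` at `λ`: it is `γ₁⁻¹ γ₃ λ⁻¹` in case (C1), and constant otherwise. -/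
def val (γ₁ γ₃ : ℝ) : ZetaParam → ℂ → ℂ
  | recip, lam => (γ₁ : ℂ)⁻¹ * (γ₃ : ℂ) * lam⁻¹
  | const ζ, _ => ζ

/-- A constant `ζ` satisfies `|ζ| ≤ ζ₀` and either (C2) `ζ ∈ Σ_ε`, `Re ζ < 0`,
or (C3) `Re ζ ≥ 0`. -/
def Admissible (ε ζ₀ : ℝ) : ZetaParam → Prop
  | recip => True
  | const ζ => ‖ζ‖ ≤ ζ₀ ∧ ((ζ ∈ sectorSet ε ∧ ζ.re < 0) ∨ 0 ≤ ζ.re)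

open Classical in
/-- The region `Γ_{ε,λ₀,ζ}` in the cases (C1), (C2) (`Re ζ < 0`) and (C3) (`Re ζ ≥ 0`). -/
def region (ν ρ₃ ε lam₀ : ℝ) : ZetaParam → Set ℂ
  | recip => regionLambda ν ρ₃ ε lam₀
  | const ζ =>
      if ζ.re < 0 then {lam | |ζ.re / ζ.im| * |lam.im| ≤ lam.re ∧ lam₀ ≤ lam.re}
      else {lam | lam₀ ≤ lam.re}

end ZetaParam

section Symbols

variable {d : ℕ} (α β : ℝ) (ζ lam : ℂ) (ξ : EuclideanSpace ℝ (Fin d))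

/-- `|ξ'|²` as a complex number. -/
def xiSq : ℂ := ((‖ξ‖ ^ 2 : ℝ) : ℂ)

/-- `A = √((2α+β+ζ)⁻¹ λ + |ξ'|²)`, principal branch. -/
def symbA : ℂ := ((2 * α + β + ζ)⁻¹ * lam + xiSq ξ) ^ (1 / 2 : ℂ)

/-- `B = √(α⁻¹ λ + |ξ'|²)`, principal branch. -/
def symbB : ℂ := ((α : ℂ)⁻¹ * lam + xiSq ξ) ^ (1 / 2 : ℂ)

/-- The Lopatinski matrix `𝕃`. -/
def lopatinski : Matrix (Fin 2) (Fin 2) ℂ :=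
  let A := symbA α β ζ lam ξ
  let B := symbB α lam ξ
  let s := xiSq ξ
  !![α * A * (B ^ 2 - s) / (A * B - s),
     α * s * (2 * A * B - s - B ^ 2) / (A * B - s);
     (2 * α * A * (B - A) - (β + ζ) * (A ^ 2 - s)) / (A * B - s),
     (2 * α + β + ζ) * B * (A ^ 2 - s) / (A * B - s)]

/-- `N(A,B) = λ det 𝕃 + σ L₁₁ (m + |ξ'|²)`. -/
def symbN (σ m : ℝ) : ℂ :=
  lam * (lopatinski α β ζ lam ξ).det + σ * lopatinski α β ζ lam ξ 0 0 * (m + xiSq ξ)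

end Symbols

/-- `N(A,B)` as a function of `(λ, ξ')`, with `α = γ₁⁻¹ μ`, `β = γ₁⁻¹ (ν - μ)`, and with the
(possibly `λ`-dependent) parameter `ζ` inserted. -/
def symbNAB (σ m μ ν γ₁ γ₃ : ℝ) (Z : ZetaParam) {d : ℕ} (lam : ℂ)
    (ξ : EuclideanSpace ℝ (Fin d)) : ℂ :=
  symbN (γ₁⁻¹ * μ) (γ₁⁻¹ * (ν - μ)) (Z.val γ₁ γ₃ lam) lam ξ σ m

/-- The operator `τ ∂_τ`, where `τ = Im λ` and `Re λ` is kept fixed. -/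
def tauDeriv (F : ℂ → ℂ) (lam : ℂ) : ℂ :=
  lam.im * deriv (fun τ : ℝ => F (lam.re + τ * Complex.I)) lam.im

/-- The partial derivative `∂^κ f (ξ)` for a multi-index `κ`: the derivative of order `|κ|`,
evaluated on the family that contains the `j`-th standard basis vector `κ j` times. -/
def multiDeriv {d : ℕ} (κ : Fin d → ℕ) (f : EuclideanSpace ℝ (Fin d) → ℂ)
    (ξ : EuclideanSpace ℝ (Fin d)) : ℂ :=
  iteratedFDeriv ℝ (∑ j, κ j) f ξ
    (fun i => EuclideanSpace.single (finSigmaFinEquiv.symm i).1 (1 : ℝ))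

end

open ComplexConjugate Filter Topology Metric

noncomputable section

/-! Write κ = α + β + ζ, L = |λ|, s = |ξ'|². Both AB - s and the Rayleigh function R = (B² + s)² -
4sAB vanish at λ = 0, so N is first rationalised: N = F (λQ + σA(m + s)) with F = λ/(AB - s) and Q =
α²R/λ, in forms that make sense at λ = 0.

The core is R ≠ 0. A zero of R would give a decaying solution, a sum of two exponentials, of the
half-space resolvent system with vanishing boundary traction. Testing it with itself yields λg + αg'
+ κg'' = 0 with g, g' ≥ 0 and g'' > 0, which is impossible when λ, 1, κ lie in an open half-plane
(`rayleigh_ne_zero`). The regions Γ are such that this half-plane exists (`DirCond.exists_half`).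

With t = L + s and h = L + √t, the quotient N/(th) becomes a function `weightedN` of variables on
the unit scale, governed by x = L/t and y = L/h. Since x(1 - y) ≤ 1/√t, only the edges x = 0 and y =
1 matter for large L. On y = 1 the surface tension disappears and Q ≠ 0 suffices; on x = 0 the
symbol is explicit. Compactness gives |N| ≥ c t h uniformly, even for complex λ and |ξ'|² in
neighbourhoods of relative size δ (`symbHol_lower_bound`); in case (C1), ζ is a small perturbation
of 0.

The bounds for N⁻¹ are then Cauchy estimates in these neighbourhoods
(`LowerBoundNear.norm_iteratedFDeriv_le`): each ξ'-derivative costs a factor of order (L +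
s)^(-1/2), and τ∂_τ costs only a constant. -/

/-! ### Energy argument for the Rayleigh function -/

/-- The inner product in `L²(0, ∞)` of `f₁ e^{-ax} + f₂ e^{-bx}` with itself is nonnegative. -/
lemma exp_gram_nonneg {a b : ℂ} (ha : 0 < a.re) (hb : 0 < b.re) (f₁ f₂ : ℂ) :
    ∃ g : ℝ, 0 ≤ g ∧ f₁ * conj f₁ / (a + conj a) + f₁ * conj f₂ / (a + conj b)
      + f₂ * conj f₁ / (b + conj a) + f₂ * conj f₂ / (b + conj b) = g := by
  have hab : a.re + b.re ≤ ‖a + conj b‖ := by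
    have := Complex.re_le_norm (a + conj b)
    simpa using this
  have hpos : 0 < ‖a + conj b‖ := by linarith
  refine ⟨‖f₁‖ ^ 2 / (2 * a.re) + 2 * (f₁ * conj f₂ / (a + conj b)).re + ‖f₂‖ ^ 2 / (2 * b.re),
    ?_, ?_⟩
  · have h1 : -(‖f₁‖ * ‖f₂‖ / ‖a + conj b‖) ≤ (f₁ * conj f₂ / (a + conj b)).re := by
      have := Complex.abs_re_le_norm (f₁ * conj f₂ / (a + conj b))
      rw [norm_div, norm_mul, Complex.norm_conj] at this
      exact (abs_le.1 this).1
    have h2 : ‖f₁‖ * ‖f₂‖ / ‖a + conj b‖ ≤ ‖f₁‖ * ‖f₂‖ / (a.re + b.re) := by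
      gcongr
    have h3 : 2 * (‖f₁‖ * ‖f₂‖ / (a.re + b.re)) ≤
        ‖f₁‖ ^ 2 / (2 * a.re) + ‖f₂‖ ^ 2 / (2 * b.re) := by
      rw [← sub_nonneg]
      have : ‖f₁‖ ^ 2 / (2 * a.re) + ‖f₂‖ ^ 2 / (2 * b.re) - 2 * (‖f₁‖ * ‖f₂‖ / (a.re + b.re))
        = ((‖f₁‖ * b.re - ‖f₂‖ * a.re) ^ 2 + a.re * b.re * (‖f₁‖ - ‖f₂‖) ^ 2)
            / (2 * a.re * b.re * (a.re + b.re)) := by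
        field_simp
        ring
      rw [this]
      positivity
    linarith
  · have e1 : f₂ * conj f₁ / (b + conj a) = conj (f₁ * conj f₂ / (a + conj b)) := by
      simp [mul_comm, add_comm]
    have e2 : f₁ * conj f₂ / (a + conj b) + conj (f₁ * conj f₂ / (a + conj b))
        = ((2 * (f₁ * conj f₂ / (a + conj b)).re : ℝ) : ℂ) := Complex.add_conj _
    rw [e1, Complex.mul_conj', Complex.mul_conj', Complex.add_conj, Complex.add_conj]
    push_cast at e2 ⊢
    linear_combination e2

/-- Energy identity for one exponential mode `(v, w) e^{-ax}` of the resolvent system, tested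
against `(V, W) e^{-cx}`. -/
lemma mode_energy {α κ lam : ℂ} {r a v w c V W : ℂ} (hac : a + c ≠ 0)
    (h1 : lam * v = α * (a ^ 2 - r ^ 2) * v + κ * (Complex.I * r) * (Complex.I * r * v - a * w))
    (h2 : lam * w = α * (a ^ 2 - r ^ 2) * w - κ * a * (Complex.I * r * v - a * w)) :
    lam * (v * V / (a + c) + w * W / (a + c))
      + α * ((Complex.I * r * v + a * w) * (-(Complex.I * r * V) + c * W) / (a + c)
        + (-(a * v) + Complex.I * r * w) * (-(c * V) - Complex.I * r * W) / (a + c))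
      + κ * ((Complex.I * r * v - a * w) * (-(Complex.I * r * V) - c * W) / (a + c))
    = -(α * (-(a * v) + Complex.I * r * w) * V
        + (-(2 * α * (a * w)) + (κ - α) * (Complex.I * r * v - a * w)) * W) := by
  have hI : Complex.I ^ 2 = -1 := Complex.I_sq
  field_simp
  linear_combination V * h1 + W * h2 - α * r ^ 2 * (v * V + w * W) * hI

/-- The Rayleigh function does not vanish when `lam`, `1` and `κ` lie in an open half-plane. -/
lemma rayleigh_ne_zero {α r : ℝ} {κ lam χ A B : ℂ} (hα : 0 < α) (hr : 0 < r) (hlam : lam ≠ 0)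
    (hχ : 0 < χ.re) (hχl : 0 < (χ * lam).re) (hχκ : 0 < (χ * κ).re)
    (hA : lam = (α + κ) * (A ^ 2 - r ^ 2)) (hB : lam = α * (B ^ 2 - r ^ 2))
    (hAre : 0 < A.re) (hBre : 0 < B.re) :
    (B ^ 2 + r ^ 2) ^ 2 - 4 * r ^ 2 * A * B ≠ 0 := by
  intro hR
  have hI : Complex.I ^ 2 = -1 := Complex.I_sq
  have hne : ∀ {a b : ℂ}, 0 < a.re → 0 < b.re → a + conj b ≠ 0 := by
    intro a b ha hb h
    have := congrArg Complex.re h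
    simp at this
    linarith
  have hB0 : B ≠ 0 := by rintro rfl; simp at hBre
  -- p and q are the amplitudes of the gradient mode (ir, -A) e^{-Ax} and of the divergence-free
  -- mode (B, ir) e^{-Bx}. The normal traction condition `t2` holds by this choice, the tangential
  -- one `t1` because R = 0.
  obtain ⟨p, hp⟩ : ∃ p : ℂ, p = 2 * Complex.I * r * B := ⟨_, rfl⟩
  obtain ⟨q, hq⟩ : ∃ q : ℂ, q = B ^ 2 + r ^ 2 := ⟨_, rfl⟩
  have hp0 : p ≠ 0 := by
    rw [hp]
    have : (r : ℂ) ≠ 0 := by exact_mod_cast hr.ne'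
    simp [this, hB0]
  have t1 : 2 * Complex.I * r * A * p + (B ^ 2 + r ^ 2) * q = 0 := by
    rw [hp, hq]; linear_combination hR + 4 * r ^ 2 * A * B * hI
  have t2 : (B ^ 2 + r ^ 2) * p - 2 * Complex.I * r * B * q = 0 := by
    rw [hp, hq]; ring
  obtain ⟨v₁, hv₁⟩ : ∃ v : ℂ, v = Complex.I * r * p := ⟨_, rfl⟩
  obtain ⟨w₁, hw₁⟩ : ∃ v : ℂ, v = -A * p := ⟨_, rfl⟩
  obtain ⟨v₂, hv₂⟩ : ∃ v : ℂ, v = B * q := ⟨_, rfl⟩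
  obtain ⟨w₂, hw₂⟩ : ∃ v : ℂ, v = Complex.I * r * q := ⟨_, rfl⟩
  have modeA := fun (c V W : ℂ) (h : A + c ≠ 0) =>
    mode_energy (α := α) (κ := κ) (lam := lam) (r := r) (a := A) (v := v₁) (w := w₁)
      (V := V) (W := W) h
      (by rw [hv₁, hw₁]; linear_combination Complex.I * r * p * hA - Complex.I * r ^ 3 * p * κ * hI)
      (by rw [hv₁, hw₁]; linear_combination - A * p * hA + A * p * r ^ 2 * κ * hI)
  have modeB := fun (c V W : ℂ) (h : B + c ≠ 0) =>
    mode_energy (α := α) (κ := κ) (lam := lam) (r := r) (a := B) (v := v₂) (w := w₂)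
      (V := V) (W := W) h
      (by rw [hv₂, hw₂]; linear_combination B * q * hB)
      (by rw [hv₂, hw₂]; linear_combination Complex.I * r * q * hB)
  have test : ∀ V W : ℂ,
      -(α * (-(A * v₁) + Complex.I * r * w₁) * V
        + (-(2 * α * (A * w₁)) + (κ - α) * (Complex.I * r * v₁ - A * w₁)) * W)
      + -(α * (-(B * v₂) + Complex.I * r * w₂) * V
        + (-(2 * α * (B * w₂)) + (κ - α) * (Complex.I * r * v₂ - B * w₂)) * W) = 0 := by
    intro V W
    rw [hv₁, hw₁, hv₂, hw₂]
    linear_combination α * V * t1 - α * W * t2 + p * W * hA - p * W * hB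
      - (α * V * r ^ 2 * q + (κ - α) * r ^ 2 * p * W) * hI
  obtain ⟨g₁, hg₁, e₁⟩ := exp_gram_nonneg hAre hBre v₁ v₂
  obtain ⟨g₂, hg₂, e₂⟩ := exp_gram_nonneg hAre hBre w₁ w₂
  obtain ⟨g₃, hg₃, e₃⟩ := exp_gram_nonneg hAre hBre
    (Complex.I * r * v₁ + A * w₁) (Complex.I * r * v₂ + B * w₂)
  obtain ⟨g₄, hg₄, e₄⟩ := exp_gram_nonneg hAre hBre
    (-(A * v₁) + Complex.I * r * w₁) (-(B * v₂) + Complex.I * r * w₂)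
  have d₂ : Complex.I * r * v₂ - B * w₂ = 0 := by rw [hv₂, hw₂]; ring
  have d₁ : Complex.I * r * v₁ - A * w₁ = (A ^ 2 - r ^ 2) * p := by
    rw [hv₁, hw₁]; linear_combination r ^ 2 * p * hI
  have hd : A ^ 2 - r ^ 2 ≠ 0 := by
    intro h; rw [h, mul_zero] at hA; exact hlam hA
  have e₅ : (Complex.I * r * v₁ - A * w₁) * conj (Complex.I * r * v₁ - A * w₁) / (A + conj A)
      = ((‖(A ^ 2 - r ^ 2) * p‖ ^ 2 / (2 * A.re) : ℝ) : ℂ) := by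
    rw [d₁, Complex.mul_conj', Complex.add_conj]; push_cast; rfl
  have hg₅ : 0 < ‖(A ^ 2 - r ^ 2) * p‖ ^ 2 / (2 * A.re) := by
    have := mul_ne_zero hd hp0
    positivity
  obtain ⟨g₅, hg₅'⟩ : ∃ g : ℝ, g = ‖(A ^ 2 - r ^ 2) * p‖ ^ 2 / (2 * A.re) := ⟨_, rfl⟩
  rw [← hg₅'] at e₅ hg₅
  -- α multiplies the trace-free part of the strain (`g₃`, `g₄`) and κ the divergence, to which only
  -- the A-mode contributes; hence κ = α + β + ζ is the quantity that must share a half-plane with 1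
  -- and λ.
  have total : lam * (g₁ + g₂) + α * (g₃ + g₄) + κ * g₅ = 0 := by
    have m1 := modeA _ (conj v₁) (conj w₁) (hne hAre hAre)
    have m2 := modeA _ (conj v₂) (conj w₂) (hne hAre hBre)
    have m3 := modeB _ (conj v₁) (conj w₁) (hne hBre hAre)
    have m4 := modeB _ (conj v₂) (conj w₂) (hne hBre hBre)
    have s1 := test (conj v₁) (conj w₁)
    have s2 := test (conj v₂) (conj w₂)
    have cd₂ : -(Complex.I * r * conj v₂) - conj B * conj w₂ = 0 := by
      have := congrArg conj d₂; simpa using this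
    rw [d₂] at m3 m4 s1 s2
    rw [cd₂] at m2 m4
    rw [← e₁, ← e₂, ← e₃, ← e₄, ← e₅]
    simp only [map_add, map_sub, map_mul, map_neg, Complex.conj_I, Complex.conj_ofReal]
    linear_combination m1 + m2 + m3 + m4 + s1 + s2
  have hre := congrArg Complex.re (congrArg (χ * ·) total)
  have : (χ * (lam * (g₁ + g₂) + α * (g₃ + g₄) + κ * g₅)).re
      = (χ * lam).re * (g₁ + g₂) + α * χ.re * (g₃ + g₄) + (χ * κ).re * g₅ := by
    simp [Complex.mul_re, Complex.mul_im]
    ring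
  simp only [mul_zero, Complex.zero_re] at hre
  rw [this] at hre
  have : 0 < (χ * κ).re * g₅ := by positivity
  have : 0 ≤ (χ * lam).re * (g₁ + g₂) + α * χ.re * (g₃ + g₄) := by positivity
  linarith

/-! ### Rationalised symbols and their non-vanishing -/

/-- The principal root `√(E⁻¹ z + w)`: it is `A` for `E = 2α + β + ζ` and `B` for `E = α`. -/
def rootSymb (E z w : ℂ) : ℂ := (E⁻¹ * z + w) ^ (1 / 2 : ℂ)

/-- `α² ((B² + w)² - 4 w A B) / z`, in a form that makes sense at `z = 0`. Here `κ = α + β + ζ`. -/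
def rayleighQuot (α κ z w : ℂ) : ℂ :=
  z + 4 * w * α - 4 * α * w * (z + (2 * α + κ) * w) /
    ((α + κ) * (rootSymb (α + κ) z w * rootSymb α z w + w))

/-- The factor `α (α + κ) (A B + w) / (z + (2α + κ) w)`, which is equal to `z / (A B - w)`. -/
def lopFactor (α κ z w : ℂ) : ℂ :=
  α * (α + κ) * (rootSymb (α + κ) z w * rootSymb α z w + w) / (z + (2 * α + κ) * w)

/-- The symbol `N(A, B)` with its two terms weighted by independent variables. -/
def weightedN (σ : ℝ) (α κ z w l r e : ℂ) : ℂ :=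
  lopFactor α κ z w * (l * rayleighQuot α κ z w + σ * r * rootSymb (α + κ) z w * (e + w))

/-- All denominators in the symbols are nonzero, and the radicands avoid the branch cut. -/
structure Regular (α κ z w : ℂ) : Prop where
  ne : α + κ ≠ 0
  ne' : α ≠ 0
  slitA : (α + κ)⁻¹ * z + w ∈ Complex.slitPlane
  slitB : α⁻¹ * z + w ∈ Complex.slitPlane
  den : z + (2 * α + κ) * w ≠ 0
  prod : rootSymb (α + κ) z w * rootSymb α z w + w ≠ 0

/-- `θ` is a unit vector such that `1, θ, κ` lie in an open half-plane, and so do `1, θ, κ̄`. -/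
structure IsGood (α : ℝ) (κ θ : ℂ) : Prop where
  pos : 0 < α
  norm : ‖θ‖ = 1
  half : ∃ χ : ℂ, 0 < χ.re ∧ 0 < (χ * θ).re ∧ 0 < (χ * κ).re
  half_conj : ∃ χ : ℂ, 0 < χ.re ∧ 0 < (χ * θ).re ∧ 0 < (χ * conj κ).re

lemma sqrt_re_pos {z : ℂ} (hz : z ∈ Complex.slitPlane) : 0 < (z ^ (1 / 2 : ℂ)).re := by
  have h0 := Complex.slitPlane_ne_zero hz
  have h1 := Complex.mem_slitPlane_iff_arg.1 hz
  have h2 := Complex.neg_pi_lt_arg z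
  have h3 : z.arg < Real.pi := lt_of_le_of_ne (Complex.arg_le_pi z) h1.1
  rw [Complex.cpow_def_of_ne_zero h0, Complex.exp_re]
  have : (Complex.log z * (1 / 2)).im = z.arg / 2 := by
    have : (1 / 2 : ℂ) = ((1 / 2 : ℝ) : ℂ) := by push_cast; rfl
    rw [this, Complex.im_mul_ofReal, Complex.log_im]; ring
  rw [this]
  exact mul_pos (Real.exp_pos _) (Real.cos_pos_of_mem_Ioo ⟨by linarith, by linarith⟩)

lemma sqrt_sq (z : ℂ) : (z ^ (1 / 2 : ℂ)) ^ 2 = z := by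
  simp

lemma rootSymb_sq (E z w : ℂ) : rootSymb E z w ^ 2 = E⁻¹ * z + w := sqrt_sq _

lemma rootSymb_zero_one (E : ℂ) : rootSymb E 0 1 = 1 := by simp [rootSymb]

/-- Points that are positive combinations of vectors in an open half-plane. -/
lemma slit_of_half {χ E θ : ℂ} (hθ : 0 < (χ * θ).re) (hE : 0 < (χ * E).re) {x y : ℝ}
    (hx : 0 ≤ x) (hy : 0 ≤ y) (hxy : 0 < x + y) :
    E⁻¹ * (x * θ) + y ∈ Complex.slitPlane := by
  have hE0 : E ≠ 0 := by rintro rfl; simp at hE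
  rw [Complex.mem_slitPlane_iff_not_le_zero]
  intro h
  obtain ⟨h1, h2⟩ := Complex.le_def.1 h
  -- A value t ≤ 0 would equate Re(χxθ) ≥ 0 with (t - y) Re(χE) ≤ 0, forcing x = 0 and y = t ≤ 0.
  obtain ⟨t, ht⟩ : ∃ t : ℝ, E⁻¹ * (x * θ) + y = t :=
    ⟨(E⁻¹ * (x * θ) + y).re, Complex.ext (by simp) (by simpa using h2)⟩
  rw [ht] at h1
  simp only [Complex.ofReal_re, Complex.zero_re] at h1
  have e : χ * (x * θ) = (t - y : ℝ) * (χ * E) := by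
    push_cast; rw [← ht]; field_simp; ring
  have e' := congrArg Complex.re e
  rw [show χ * (x * θ) = x * (χ * θ) by ring, Complex.re_ofReal_mul, Complex.re_ofReal_mul] at e'
  have : 0 ≤ x * (χ * θ).re := by positivity
  have h3 : (t - y) * (χ * E).re ≤ 0 := mul_nonpos_of_nonpos_of_nonneg (by linarith) hE.le
  have h4 : x * (χ * θ).re = 0 := by linarith
  have h5 : x = 0 := by
    rcases mul_eq_zero.1 h4 with h | h
    · exact h
    · exact absurd h hθ.ne'
  have h6 : t - y = 0 := by
    rw [h5, zero_mul] at e'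
    rcases mul_eq_zero.1 e'.symm with h | h
    · exact h
    · exact absurd h hE.ne'
  linarith

/-- This is the rationalisation: division by AB - w, which degenerates at z = 0, is traded for
multiplication by AB + w, which does not. -/
lemma prod_identity {α κ z w : ℂ} (hD : α + κ ≠ 0) (hα : α ≠ 0) :
    α * (α + κ) * ((rootSymb (α + κ) z w * rootSymb α z w - w) *
      (rootSymb (α + κ) z w * rootSymb α z w + w)) = z * (z + (2 * α + κ) * w) := by
  have hA := rootSymb_sq (α + κ) z w
  have hB := rootSymb_sq α z w
  have : (rootSymb (α + κ) z w * rootSymb α z w - w) *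
      (rootSymb (α + κ) z w * rootSymb α z w + w) =
      ((α + κ)⁻¹ * z + w) * (α⁻¹ * z + w) - w ^ 2 := by
    rw [← hA, ← hB]; ring
  rw [this]
  field_simp
  ring

lemma regular_of_good {α : ℝ} {κ θ : ℂ} (h : IsGood α κ θ) {x y : ℝ} (hx : 0 ≤ x) (hy : 0 ≤ y)
    (hxy : 0 < x + y) : Regular α κ (x * θ) y := by
  obtain ⟨χ, h1, h2, h3⟩ := h.half
  have hα := h.pos
  have hχα : 0 < (χ * α).re := by rw [Complex.re_mul_ofReal]; positivity
  have hχD : 0 < (χ * (α + κ)).re := by rw [mul_add, Complex.add_re]; positivity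
  have hD : (α : ℂ) + κ ≠ 0 := by intro h; rw [h] at hχD; simp at hχD
  have hα0 : (α : ℂ) ≠ 0 := by exact_mod_cast hα.ne'
  have sA := slit_of_half h2 hχD hx hy hxy
  have sB := slit_of_half h2 hχα hx hy hxy
  have den : (x * θ : ℂ) + (2 * α + κ) * y ≠ 0 := by
    intro h0
    have e := congrArg Complex.re (congrArg (χ * ·) h0)
    simp only [mul_zero, Complex.zero_re] at e
    rw [show χ * ((x * θ : ℂ) + (2 * α + κ) * y) =
      x * (χ * θ) + y * (χ * α + χ * (α + κ)) by ring, Complex.add_re, Complex.re_ofReal_mul,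
      Complex.re_ofReal_mul, Complex.add_re] at e
    have a1 : 0 ≤ x * (χ * θ).re := by positivity
    have a2 : 0 ≤ y * ((χ * α).re + (χ * (α + κ)).re) := by positivity
    rcases hx.eq_or_lt with hx0 | hx0
    · have : 0 < y := by linarith
      have : 0 < y * ((χ * α).re + (χ * (α + κ)).re) := by positivity
      linarith
    · have : 0 < x * (χ * θ).re := by positivity
      linarith
  refine ⟨hD, hα0, sA, sB, den, ?_⟩
  -- If AB + w = 0, then `prod_identity` forces z = 0, hence A = B = √y and AB + w = 2y > 0.
  intro h0
  have e := prod_identity (z := x * θ) (w := y) hD hα0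
  rw [h0, mul_zero, mul_zero] at e
  have hθ : θ ≠ 0 := by rintro rfl; simp at h2
  have hx0 : x = 0 := by
    rcases mul_eq_zero.1 e.symm with h | h
    · rcases mul_eq_zero.1 h with h | h
      · exact_mod_cast h
      · exact absurd h hθ
    · exact absurd h den
  subst hx0
  have hy0 : 0 < y := by linarith
  have : rootSymb (α + κ) ((0 : ℝ) * θ) y * rootSymb α ((0 : ℝ) * θ) y = y := by
    have : ∀ E, rootSymb E ((0 : ℝ) * θ) y = (y : ℂ) ^ (1 / 2 : ℂ) := by intro E; simp [rootSymb]
    rw [this, this, ← pow_two, sqrt_sq]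
  rw [this] at h0
  norm_cast at h0
  linarith

lemma lopFactor_ne_zero {α κ z w : ℂ} (h : Regular α κ z w) : lopFactor α κ z w ≠ 0 :=
  div_ne_zero (mul_ne_zero (mul_ne_zero h.ne' h.ne) h.prod) h.den

lemma mul_rayleighQuot {α κ z w : ℂ} (h : Regular α κ z w) :
    z * rayleighQuot α κ z w = α ^ 2 * ((rootSymb α z w ^ 2 + w) ^ 2
      - 4 * w * rootSymb (α + κ) z w * rootSymb α z w) := by
  have e := prod_identity (z := z) (w := w) h.ne h.ne'
  have hB := rootSymb_sq α z w
  have hB' : α * (rootSymb α z w ^ 2 - w) = z := by rw [hB]; field_simp [h.ne']; ring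
  have h1 := h.prod
  have h2 := h.ne
  have h3 := h.ne'
  have e2 : z * (z + (2 * α + κ) * w) / ((α + κ) * (rootSymb (α + κ) z w * rootSymb α z w + w))
      = α * (rootSymb (α + κ) z w * rootSymb α z w - w) := by
    rw [← e]; field_simp
  rw [rayleighQuot]
  have e3 : z * (z + 4 * w * α - 4 * α * w * (z + (2 * α + κ) * w) /
    ((α + κ) * (rootSymb (α + κ) z w * rootSymb α z w + w))) = z ^ 2 + 4 * w * α * z
      - 4 * α * w * (z * (z + (2 * α + κ) * w) /
        ((α + κ) * (rootSymb (α + κ) z w * rootSymb α z w + w))) := by ring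
  rw [e3, e2]
  generalize rootSymb α z w = B at *
  generalize rootSymb (α + κ) z w = A at *
  rw [← hB']
  ring

lemma rayleighQuot_zero_one {α κ : ℂ} (hD : α + κ ≠ 0) :
    rayleighQuot α κ 0 1 = 2 * α * κ / (α + κ) := by
  rw [rayleighQuot, rootSymb_zero_one, rootSymb_zero_one]
  field_simp
  ring

/-- The energy argument covers x, y > 0. At x = 0 the quotient has the value 2ακ/(α + κ), and at y =
0 it is z itself. -/
lemma rayleighQuot_ne_zero {α : ℝ} {κ θ : ℂ} (h : IsGood α κ θ) {x y : ℝ} (hx : 0 ≤ x)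
    (hy : 0 ≤ y) (hxy : x + y = 1) : rayleighQuot α κ (x * θ) y ≠ 0 := by
  have hreg := regular_of_good h hx hy (by linarith)
  obtain ⟨χ, h1, h2, h3⟩ := h.half
  have hα := h.pos
  have hκ : κ ≠ 0 := by rintro rfl; simp at h3
  have hθ : θ ≠ 0 := by rintro rfl; simp at h2
  rcases hx.eq_or_lt with rfl | hx0
  · have : y = 1 := by linarith
    subst this
    simp only [Complex.ofReal_zero, zero_mul, Complex.ofReal_one]
    rw [rayleighQuot_zero_one hreg.ne]
    exact div_ne_zero (mul_ne_zero (mul_ne_zero two_ne_zero hreg.ne') hκ) hreg.ne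
  have hx0' : (x : ℂ) ≠ 0 := by exact_mod_cast hx0.ne'
  rcases hy.eq_or_lt with rfl | hy0
  · simp [rayleighQuot, hx0', hθ]
  intro h0
  have e := mul_rayleighQuot hreg
  rw [h0, mul_zero] at e
  have hα2 : (α : ℂ) ^ 2 ≠ 0 := pow_ne_zero _ hreg.ne'
  have e' := (mul_eq_zero.1 e.symm).resolve_left hα2
  have hs : ((√y : ℝ) : ℂ) ^ 2 = y := by exact_mod_cast Real.sq_sqrt hy
  refine rayleigh_ne_zero (α := α) (r := √y) (κ := κ) (lam := x * θ) (χ := χ)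
    (A := rootSymb (α + κ) (x * θ) y) (B := rootSymb α (x * θ) y)
    hα (Real.sqrt_pos.2 hy0) (mul_ne_zero hx0' hθ) h1 ?_ h3 ?_ ?_
    (sqrt_re_pos hreg.slitA) (sqrt_re_pos hreg.slitB) ?_
  · rw [show χ * (x * θ) = x * (χ * θ) by ring, Complex.re_ofReal_mul]; positivity
  · rw [hs, rootSymb_sq]; have := hreg.ne; field_simp; ring
  · rw [hs, rootSymb_sq]; have := hreg.ne'; field_simp; ring
  · rw [hs]; exact e'

/-- For y = 1 the surface term is absent and the Rayleigh quotient decides. For x = 0, multiplying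
the bracket by (α + κ)/κ leaves 2αyθ + σ(1 - y)(1 + α/κ); as 1/κ is a positive multiple of the
conjugate of κ, `half_conj` is the condition needed here. -/
lemma weightedN_ne_zero {σ α : ℝ} {κ θ : ℂ} (hσ : 0 < σ) (h : IsGood α κ θ) {x y : ℝ}
    (hx : x ∈ Set.Icc (0 : ℝ) 1) (hy : y ∈ Set.Icc (0 : ℝ) 1) (hxy : x = 0 ∨ y = 1) :
    weightedN σ α κ (x * θ) (1 - x) (y * θ) (1 - y) 0 ≠ 0 := by
  have hreg := regular_of_good h hx.1 (sub_nonneg.2 hx.2) (by linarith)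
  have hray := rayleighQuot_ne_zero h hx.1 (sub_nonneg.2 hx.2) (by linarith)
  have hα := h.pos
  push_cast at hreg hray
  refine mul_ne_zero (lopFactor_ne_zero hreg) ?_
  rcases hxy with rfl | rfl
  · obtain ⟨χ, h1, h2, h3⟩ := h.half_conj
    have hκ : κ ≠ 0 := by rintro rfl; simp at h3
    simp only [Complex.ofReal_zero, zero_mul, sub_zero, zero_add]
    rw [rayleighQuot_zero_one hreg.ne, rootSymb_zero_one]
    intro h0
    have hD := hreg.ne
    have h4 : 2 * α * y * (χ * θ) + σ * (1 - y) * (χ + α * (χ * κ⁻¹)) = 0 := by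
      field_simp at h0 ⊢
      linear_combination χ * h0
    have e := congrArg Complex.re h4
    have h5 : (χ * κ⁻¹).re = (χ * conj κ).re / Complex.normSq κ := by
      rw [Complex.inv_def, ← mul_assoc, Complex.re_mul_ofReal]; rfl
    have h6 : 0 < (χ * κ⁻¹).re := by
      rw [h5]; exact div_pos h3 (Complex.normSq_pos.2 hκ)
    have e1 : (2 * α * y * (χ * θ) + σ * (1 - y) * (χ + α * (χ * κ⁻¹)) : ℂ) =
      ((2 * α * y : ℝ) : ℂ) * (χ * θ) + ((σ * (1 - y) : ℝ) : ℂ) * (χ + α * (χ * κ⁻¹)) := by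
      push_cast; ring
    rw [e1, Complex.add_re, Complex.re_ofReal_mul, Complex.re_ofReal_mul, Complex.add_re,
      Complex.re_ofReal_mul, Complex.zero_re] at e
    have hy1 : 0 ≤ 1 - y := sub_nonneg.2 hy.2
    have hy0 := hy.1
    have a1 : 0 ≤ 2 * α * y * (χ * θ).re := by positivity
    have a2 : 0 ≤ σ * (1 - y) * (χ.re + α * (χ * κ⁻¹).re) := by positivity
    rcases hy0.eq_or_lt with rfl | hy0'
    · have : 0 < σ * (1 - 0) * (χ.re + α * (χ * κ⁻¹).re) := by simp only [sub_zero, mul_one]; positivity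
      linarith
    · have : 0 < 2 * α * y * (χ * θ).re := by positivity
      linarith
  · have hθ : θ ≠ 0 := by
      obtain ⟨χ, h1, h2, h3⟩ := h.half
      rintro rfl; simp at h2
    simpa using ⟨hθ, hray⟩

/-! ### Analyticity of the symbols -/

section Analytic

variable {E : Type*} [NormedAddCommGroup E] [NormedSpace ℂ E]

lemma AnalyticAt.rootSymb {f z w : E → ℂ} {x : E} (hf : AnalyticAt ℂ f x) (hz : AnalyticAt ℂ z x)
    (hw : AnalyticAt ℂ w x) (h0 : f x ≠ 0) (hs : (f x)⁻¹ * z x + w x ∈ Complex.slitPlane) :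
    AnalyticAt ℂ (fun p => rootSymb (f p) (z p) (w p)) x :=
  (((hf.inv h0).mul hz).add hw).cpow analyticAt_const hs

variable {α κ z w : E → ℂ} {x : E} (hα : AnalyticAt ℂ α x) (hκ : AnalyticAt ℂ κ x)
  (hz : AnalyticAt ℂ z x) (hw : AnalyticAt ℂ w x) (h : Regular (α x) (κ x) (z x) (w x))

include hα hκ hz hw h

lemma Regular.analyticAt_root :
    AnalyticAt ℂ (fun p => rootSymb (α p + κ p) (z p) (w p)) x ∧
    AnalyticAt ℂ (fun p => rootSymb (α p) (z p) (w p)) x :=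
  ⟨(hα.add hκ).rootSymb hz hw h.ne h.slitA, hα.rootSymb hz hw h.ne' h.slitB⟩

lemma Regular.analyticAt_lopFactor :
    AnalyticAt ℂ (fun p => lopFactor (α p) (κ p) (z p) (w p)) x := by
  obtain ⟨hA, hB⟩ := Regular.analyticAt_root hα hκ hz hw h
  exact AnalyticAt.div (by fun_prop) (by fun_prop) h.den

lemma Regular.analyticAt_rayleighQuot :
    AnalyticAt ℂ (fun p => rayleighQuot (α p) (κ p) (z p) (w p)) x := by
  obtain ⟨hA, hB⟩ := Regular.analyticAt_root hα hκ hz hw h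
  have hq : AnalyticAt ℂ (fun p => 4 * α p * w p * (z p + (2 * α p + κ p) * w p) /
      ((α p + κ p) * (_root_.rootSymb (α p + κ p) (z p) (w p) *
        _root_.rootSymb (α p) (z p) (w p) + w p))) x :=
    AnalyticAt.div (by fun_prop) (by fun_prop) (mul_ne_zero h.ne h.prod)
  have : AnalyticAt ℂ (fun p => z p + 4 * w p * α p) x := by fun_prop
  exact this.sub hq

lemma Regular.analyticAt_weightedN (σ : ℝ) {l r e : E → ℂ} (hl : AnalyticAt ℂ l x)
    (hr : AnalyticAt ℂ r x) (he : AnalyticAt ℂ e x) :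
    AnalyticAt ℂ (fun p => weightedN σ (α p) (κ p) (z p) (w p) (l p) (r p) (e p)) x := by
  obtain ⟨hA, hB⟩ := Regular.analyticAt_root hα hκ hz hw h
  have h1 := Regular.analyticAt_lopFactor hα hκ hz hw h
  have h2 := Regular.analyticAt_rayleighQuot hα hκ hz hw h
  unfold weightedN
  fun_prop

lemma Regular.eventually : ∀ᶠ p in 𝓝 x, Regular (α p) (κ p) (z p) (w p) := by
  obtain ⟨hA, hB⟩ := Regular.analyticAt_root hα hκ hz hw h
  have cα := hα.continuousAt
  have cκ := hκ.continuousAt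
  have cz := hz.continuousAt
  have cw := hw.continuousAt
  have cA := hA.continuousAt
  have cB := hB.continuousAt
  have c1 := (cα.add cκ).eventually_ne h.ne
  have c2 := cα.eventually_ne h.ne'
  have c3 := ((((cα.add cκ).inv₀ h.ne).mul cz).add cw).eventually_mem
    (Complex.isOpen_slitPlane.mem_nhds h.slitA)
  have c4 := (((cα.inv₀ h.ne').mul cz).add cw).eventually_mem
    (Complex.isOpen_slitPlane.mem_nhds h.slitB)
  have c5 : ∀ᶠ p in 𝓝 x, z p + (2 * α p + κ p) * w p ≠ 0 :=
    ContinuousAt.eventually_ne (by fun_prop) h.den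
  have c6 := ((cA.mul cB).add cw).eventually_ne h.prod
  filter_upwards [c1, c2, c3, c4, c5, c6] with p h1 h2 h3 h4 h5 h6
  exact ⟨h1, h2, h3, h4, h5, h6⟩

end Analytic

/-! ### Compactness on the unit scale -/

/-- `weightedN` as a function on `ℂ⁷`. -/
def weightedNFun (σ : ℝ) (p : Fin 7 → ℂ) : ℂ :=
  weightedN σ (p 0) (p 1) (p 2) (p 3) (p 4) (p 5) (p 6)

lemma analyticAt_coord {n : ℕ} (i : Fin n) (p : Fin n → ℂ) :
    AnalyticAt ℂ (fun q : Fin n → ℂ => q i) p :=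
  (ContinuousLinearMap.proj (R := ℂ) (φ := fun _ : Fin n => ℂ) i).analyticAt p

lemma analyticAt_weightedNFun (σ : ℝ) {p : Fin 7 → ℂ} (h : Regular (p 0) (p 1) (p 2) (p 3)) :
    AnalyticAt ℂ (weightedNFun σ) p :=
  Regular.analyticAt_weightedN (analyticAt_coord 0 p) (analyticAt_coord 1 p) (analyticAt_coord 2 p)
    (analyticAt_coord 3 p) h σ (analyticAt_coord 4 p) (analyticAt_coord 5 p) (analyticAt_coord 6 p)

lemma isOpen_weightedNFun_ne_zero (σ : ℝ) :
    IsOpen {p : Fin 7 → ℂ | Regular (p 0) (p 1) (p 2) (p 3) ∧ weightedNFun σ p ≠ 0} := by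
  refine isOpen_iff_mem_nhds.2 fun p hp => ?_
  have h1 := Regular.eventually (analyticAt_coord 0 p) (analyticAt_coord 1 p)
    (analyticAt_coord 2 p) (analyticAt_coord 3 p) hp.1
  filter_upwards [h1, (analyticAt_weightedNFun σ hp.1).continuousAt.eventually_ne hp.2]
    with q h1 h2
  exact ⟨h1, h2⟩

/-- The points, on the unit scale, near which the symbol has to be bounded from below. -/
def limitPoint (p : (ℝ × ℂ × ℂ) × ℝ × ℝ) : Fin 7 → ℂ :=
  ![p.1.1, p.1.2.1, p.2.1 * p.1.2.2, 1 - p.2.1, p.2.2 * p.1.2.2, 1 - p.2.2, 0]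

lemma continuous_limitPoint : Continuous limitPoint := by
  refine continuous_pi fun i => ?_
  fin_cases i <;> simp [limitPoint] <;> fun_prop

lemma limitPoint_regular {σ : ℝ} (hσ : 0 < σ) {q : ℝ × ℂ × ℂ} (hg : IsGood q.1 q.2.1 q.2.2)
    {x y : ℝ} (hx : x ∈ Set.Icc (0 : ℝ) 1) (hy : y ∈ Set.Icc (0 : ℝ) 1) (hxy : x = 0 ∨ y = 1) :
    limitPoint (q, x, y) ∈
      {p : Fin 7 → ℂ | Regular (p 0) (p 1) (p 2) (p 3) ∧ weightedNFun σ p ≠ 0} := by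
  have hr := regular_of_good hg hx.1 (sub_nonneg.2 hx.2) (by linarith)
  push_cast at hr
  exact ⟨hr, weightedN_ne_zero hσ hg hx hy hxy⟩

lemma dist_limitPoint_le {δ : ℝ} (hδ : 0 ≤ δ) {α x y : ℝ} {κ₀ θ κ z w l r e : ℂ}
    (h1 : ‖κ - κ₀‖ ≤ δ) (h2 : ‖z - x * θ‖ ≤ δ) (h3 : ‖w - (1 - x)‖ ≤ δ)
    (h4 : ‖l - y * θ‖ ≤ δ) (h5 : ‖r - (1 - y)‖ ≤ δ) (h6 : ‖e‖ ≤ δ) :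
    dist ![(α : ℂ), κ, z, w, l, r, e] (limitPoint ((α, κ₀, θ), x, y)) ≤ δ := by
  refine (dist_pi_le_iff hδ).2 fun i => ?_
  rw [dist_eq_norm]
  fin_cases i
  · simpa [limitPoint] using hδ
  · exact h1
  · exact h2
  · exact h3
  · exact h4
  · exact h5
  · simpa [limitPoint] using h6

/-- The limit points form a compact subset of the open set where the symbol is regular and nonzero.
A closed thickening still lies in that set, and the modulus has a positive minimum on it. The width
δ of the thickening pays both for the complex neighbourhood and for replacing (x, y) by a point of
the two edges. -/
lemma weightedN_lower_bound {K : Set (ℝ × ℂ × ℂ)} (hK : IsCompact K)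
    (hgood : ∀ q ∈ K, IsGood q.1 q.2.1 q.2.2) {σ : ℝ} (hσ : 0 < σ) :
    ∃ δ : ℝ, 0 < δ ∧ ∃ c : ℝ, 0 < c ∧ ∀ (α : ℝ) (κ₀ θ : ℂ), (α, κ₀, θ) ∈ K → ∀ x y : ℝ,
      x ∈ Set.Icc (0 : ℝ) 1 → y ∈ Set.Icc (0 : ℝ) 1 → (x = 0 ∨ y = 1) →
      ∀ κ z w l r e : ℂ, ‖κ - κ₀‖ ≤ δ → ‖z - x * θ‖ ≤ δ → ‖w - (1 - x)‖ ≤ δ →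
        ‖l - y * θ‖ ≤ δ → ‖r - (1 - y)‖ ≤ δ → ‖e‖ ≤ δ →
        Regular α κ z w ∧ c ≤ ‖weightedN σ α κ z w l r e‖ := by
  let S : Set ((ℝ × ℂ × ℂ) × ℝ × ℝ) :=
    K ×ˢ ((Set.Icc (0 : ℝ) 1 ×ˢ Set.Icc (0 : ℝ) 1) ∩ {p : ℝ × ℝ | p.1 = 0 ∨ p.2 = 1})
  have hS : IsCompact S := by
    refine hK.prod ((isCompact_Icc.prod isCompact_Icc).inter_right ?_)
    exact (isClosed_eq continuous_fst continuous_const).union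
      (isClosed_eq continuous_snd continuous_const)
  have hQ := hS.image continuous_limitPoint
  have hQU : limitPoint '' S ⊆
      {p : Fin 7 → ℂ | Regular (p 0) (p 1) (p 2) (p 3) ∧ weightedNFun σ p ≠ 0} := by
    rintro _ ⟨⟨q, x, y⟩, ⟨hk, ⟨hx, hy⟩, hxy⟩, rfl⟩
    exact limitPoint_regular hσ (hgood _ hk) hx hy hxy
  obtain ⟨δ, hδ, hsub⟩ := hQ.exists_cthickening_subset_open (isOpen_weightedNFun_ne_zero σ) hQU
  have hC : IsCompact (Metric.cthickening δ (limitPoint '' S)) := hQ.cthickening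
  obtain ⟨c, hc, hle⟩ := hC.exists_forall_le' (f := fun p => ‖weightedNFun σ p‖) (a := 0)
    (fun p hp => (analyticAt_weightedNFun σ (hsub hp).1).continuousAt.norm.continuousWithinAt)
    (fun p hp => norm_pos_iff.2 (hsub hp).2)
  refine ⟨δ, hδ, c, hc, fun α κ₀ θ hq x y hx hy hxy κ z w l r e h1 h2 h3 h4 h5 h6 => ?_⟩
  have hS' : limitPoint ((α, κ₀, θ), x, y) ∈ limitPoint '' S :=
    Set.mem_image_of_mem _ (Set.mem_prod.2 ⟨hq, ⟨hx, hy⟩, hxy⟩)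
  have hd := dist_limitPoint_le (α := α) hδ.le h1 h2 h3 h4 h5 h6
  generalize limitPoint ((α, κ₀, θ), x, y) = p₀ at hS' hd
  generalize hp : ![(α : ℂ), κ, z, w, l, r, e] = p at hd
  have hmem := Metric.mem_cthickening_of_dist_le p p₀ δ _ hS' hd
  have h7 := (hsub hmem).1
  have h8 := hle p hmem
  subst hp
  exact ⟨h7, h8⟩

/-! ### Scaling and the uniform lower bound -/

/-- The symbol `N(A, B)` as a function of the complex variables `z = λ` and `w = |ξ'|²`. -/
def symbHol (σ m : ℝ) (α κ z w : ℂ) : ℂ :=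
  lopFactor α κ z w * (z * rayleighQuot α κ z w + σ * rootSymb (α + κ) z w * (m + w))

lemma mul_mem_slitPlane {t : ℝ} (ht : 0 < t) {z : ℂ} (hz : z ∈ Complex.slitPlane) :
    t * z ∈ Complex.slitPlane := by
  rw [Complex.mem_slitPlane_iff] at hz ⊢
  rw [Complex.re_ofReal_mul, Complex.im_ofReal_mul]
  rcases hz with h | h
  · exact Or.inl (mul_pos ht h)
  · exact Or.inr (mul_ne_zero ht.ne' h)

lemma rootSymb_scale {t : ℝ} (ht : 0 < t) (E z w : ℂ) :
    rootSymb E (t * z) (t * w) = (√t : ℝ) * rootSymb E z w := by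
  have h : E⁻¹ * (t * z) + t * w = (t : ℂ) * (E⁻¹ * z + w) := by ring
  have h2 : ((t : ℂ) ^ (1 / 2 : ℂ)) = (√t : ℝ) := by
    rw [Real.sqrt_eq_rpow, Complex.ofReal_cpow ht.le]; norm_num
  have ht' : (t : ℂ) ≠ 0 := by exact_mod_cast ht.ne'
  rw [rootSymb, h, ← h2, rootSymb]
  rcases eq_or_ne (E⁻¹ * z + w) 0 with h0 | h0
  · simp [h0]
  · rw [Complex.cpow_def_of_ne_zero (mul_ne_zero ht' h0), Complex.cpow_def_of_ne_zero ht',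
      Complex.cpow_def_of_ne_zero h0, Complex.log_ofReal_mul ht h0, Complex.ofReal_log ht.le,
      add_mul, Complex.exp_add]

lemma sqrt_mul_sqrt_complex {t : ℝ} (ht : 0 ≤ t) : ((√t : ℝ) : ℂ) * (√t : ℝ) = t := by
  exact_mod_cast Real.mul_self_sqrt ht

lemma prod_scale {t : ℝ} (ht : 0 < t) (α κ z w : ℂ) :
    rootSymb (α + κ) (t * z) (t * w) * rootSymb α (t * z) (t * w) + t * w
      = t * (rootSymb (α + κ) z w * rootSymb α z w + w) := by
  rw [rootSymb_scale ht, rootSymb_scale ht]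
  linear_combination rootSymb (α + κ) z w * rootSymb α z w * sqrt_mul_sqrt_complex ht.le

lemma lopFactor_scale {t : ℝ} (ht : 0 < t) (α κ z w : ℂ) :
    lopFactor α κ (t * z) (t * w) = lopFactor α κ z w := by
  have h : (t : ℂ) ≠ 0 := by exact_mod_cast ht.ne'
  rw [lopFactor, prod_scale ht, lopFactor,
    show (t : ℂ) * z + (2 * α + κ) * (t * w) = t * (z + (2 * α + κ) * w) by ring,
    show α * (α + κ) * (t * (rootSymb (α + κ) z w * rootSymb α z w + w)) =
      t * (α * (α + κ) * (rootSymb (α + κ) z w * rootSymb α z w + w)) by ring,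
    mul_div_mul_left _ _ h]

lemma rayleighQuot_scale {t : ℝ} (ht : 0 < t) (α κ z w : ℂ) :
    rayleighQuot α κ (t * z) (t * w) = t * rayleighQuot α κ z w := by
  have h : (t : ℂ) ≠ 0 := by exact_mod_cast ht.ne'
  rw [rayleighQuot, prod_scale ht, rayleighQuot,
    show 4 * α * (t * w) * ((t : ℂ) * z + (2 * α + κ) * (t * w)) =
      t * (t * (4 * α * w * (z + (2 * α + κ) * w))) by ring,
    show (α + κ) * ((t : ℂ) * (rootSymb (α + κ) z w * rootSymb α z w + w)) =
      t * ((α + κ) * (rootSymb (α + κ) z w * rootSymb α z w + w)) by ring,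
    mul_div_mul_left _ _ h]
  ring

lemma Regular.scale {t : ℝ} (ht : 0 < t) {α κ z w : ℂ} (h : Regular α κ z w) :
    Regular α κ (t * z) (t * w) := by
  have h0 : (t : ℂ) ≠ 0 := by exact_mod_cast ht.ne'
  refine ⟨h.ne, h.ne', ?_, ?_, ?_, ?_⟩
  · rw [show (α + κ)⁻¹ * (t * z) + t * w = (t : ℂ) * ((α + κ)⁻¹ * z + w) by ring]
    exact mul_mem_slitPlane ht h.slitA
  · rw [show α⁻¹ * (t * z) + t * w = (t : ℂ) * (α⁻¹ * z + w) by ring]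
    exact mul_mem_slitPlane ht h.slitB
  · rw [show (t : ℂ) * z + (2 * α + κ) * (t * w) = t * (z + (2 * α + κ) * w) by ring]
    exact mul_ne_zero h0 h.den
  · rw [prod_scale ht]
    exact mul_ne_zero h0 h.prod

/-- t is the size of (λ, |ξ'|²). The competing terms λQ and σA(m + w) have sizes Lt and t^(3/2), so
the choice h = L + √t keeps both weights at most of order one. -/
lemma symbHol_scale {t h : ℝ} (ht : 0 < t) (hh : 0 < h) (σ m : ℝ) (α κ z w : ℂ) :
    symbHol σ m α κ (t * z) (t * w) =
      t * h * weightedN σ α κ z w (t * z / h) ((√t / h : ℝ)) ((m / t : ℝ)) := by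
  have h0 : (t : ℂ) ≠ 0 := by exact_mod_cast ht.ne'
  have h1 : (h : ℂ) ≠ 0 := by exact_mod_cast hh.ne'
  rw [symbHol, lopFactor_scale ht, rayleighQuot_scale ht, rootSymb_scale ht, weightedN]
  push_cast
  field_simp

/-- Uniform lower bound of the symbol in a complex neighbourhood. -/
theorem symbHol_lower_bound {K : Set (ℝ × ℂ × ℂ)} (hK : IsCompact K)
    (hgood : ∀ q ∈ K, IsGood q.1 q.2.1 q.2.2) {σ m : ℝ} (hσ : 0 < σ) (hm : 0 < m) :
    ∃ δ : ℝ, 0 < δ ∧ δ ≤ 1 / 2 ∧ ∃ lam₀ : ℝ, 1 ≤ lam₀ ∧ ∃ c : ℝ, 0 < c ∧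
      ∀ (α : ℝ) (κ₀ θ : ℂ), (α, κ₀, θ) ∈ K → ∀ L s : ℝ, lam₀ ≤ L → 0 ≤ s →
      ∀ κ z w : ℂ, ‖κ - κ₀‖ ≤ δ → ‖z - L * θ‖ ≤ δ * L → ‖w - s‖ ≤ δ * (L + s) →
        Regular α κ z w ∧ c * ((L + √(L + s)) * (L + s)) ≤ ‖symbHol σ m α κ z w‖ := by
  obtain ⟨δ, hδ, c, hc, H⟩ := weightedN_lower_bound hK hgood hσ
  -- One half of δ is spent on the displacement of (z, w), the other on moving (x, y) to an edge. L
  -- ≥ (4/δ²)² gives x(1 - y) ≤ δ²/4, so x ≤ δ/2 or 1 - y ≤ δ/2; L ≥ m/δ gives m/t ≤ δ.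
  refine ⟨min (1 / 2) (δ / 2), by positivity, min_le_left _ _,
    max 1 (max ((4 / δ ^ 2) ^ 2) (m / δ)), le_max_left _ _, c, hc, ?_⟩
  intro α κ₀ θ hq L s hL hs κ z w hκ hz hw
  have hd2 : min (1 / 2) (δ / 2) ≤ δ / 2 := min_le_right _ _
  set d := min (1 / 2) (δ / 2) with hd
  have hL1 : 1 ≤ L := (le_max_left _ _).trans hL
  have hL2 : (4 / δ ^ 2) ^ 2 ≤ L := (le_max_left _ _).trans ((le_max_right _ _).trans hL)
  have hL3 : m / δ ≤ L := (le_max_right _ _).trans ((le_max_right _ _).trans hL)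
  have hθ : ‖θ‖ = 1 := (hgood _ hq).norm
  obtain ⟨t, ht⟩ : ∃ t, t = L + s := ⟨_, rfl⟩
  rw [← ht] at hw ⊢
  have hLt : L ≤ t := by linarith
  have ht0 : 0 < t := by linarith
  have hst : 0 < √t := Real.sqrt_pos.2 ht0
  obtain ⟨h, hh⟩ : ∃ h, h = L + √t := ⟨_, rfl⟩
  rw [← hh]
  have hLh : L ≤ h := by linarith
  have hh0 : 0 < h := by linarith
  have htC : (t : ℂ) ≠ 0 := by exact_mod_cast ht0.ne'
  have hhC : (h : ℂ) ≠ 0 := by exact_mod_cast hh0.ne'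
  have hx : L / t ∈ Set.Icc (0 : ℝ) 1 := ⟨by positivity, (div_le_one ht0).2 hLt⟩
  have hy : L / h ∈ Set.Icc (0 : ℝ) 1 := ⟨by positivity, (div_le_one hh0).2 hLh⟩
  have ez : ‖z / t - (L / t : ℝ) * θ‖ ≤ δ / 2 := by
    rw [show z / t - (L / t : ℝ) * θ = (z - L * θ) / t by push_cast; ring, norm_div,
      Complex.norm_of_nonneg ht0.le, div_le_iff₀ ht0]
    exact hz.trans (by gcongr)
  have ew : ‖w / t - (1 - (L / t : ℝ))‖ ≤ δ / 2 := by
    have : w / t - (1 - (L / t : ℝ)) = (w - s) / t := by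
      push_cast; field_simp; rw [ht]; push_cast; ring
    rw [this, norm_div, Complex.norm_of_nonneg ht0.le, div_le_iff₀ ht0]
    exact hw.trans (by gcongr)
  have el : ‖t * (z / t) / h - (L / h : ℝ) * θ‖ ≤ δ / 2 := by
    rw [show t * (z / t) / h - (L / h : ℝ) * θ = (z - L * θ) / h by push_cast; field_simp,
      norm_div, Complex.norm_of_nonneg hh0.le, div_le_iff₀ hh0]
    exact hz.trans (by gcongr)
  have er : √t / h = 1 - L / h := by field_simp; linarith
  have ee : ‖((m / t : ℝ) : ℂ)‖ ≤ δ := by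
    rw [Complex.norm_of_nonneg (by positivity), div_le_iff₀ ht0]
    rw [div_le_iff₀ hδ] at hL3
    nlinarith
  have hprod : L / t * (1 - L / h) ≤ δ ^ 2 / 4 := by
    have h1 : 4 / δ ^ 2 ≤ √t := Real.le_sqrt_of_sq_le (hL2.trans hLt)
    have h2 : L / t * (1 - L / h) = L / h / √t := by
      rw [← er]
      have := Real.mul_self_sqrt ht0.le
      field_simp
      linear_combination this
    rw [h2, div_le_iff₀ hst]
    rw [div_le_iff₀ (by positivity)] at h1
    nlinarith [hy.2]
  have hN := symbHol_scale ht0 hh0 σ m α κ (z / t) (w / t)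
  have ezt : (t : ℂ) * (z / t) = z := by field_simp
  have ewt : (t : ℂ) * (w / t) = w := by field_simp
  have key : Regular α κ (z / t) (w / t) ∧
      c ≤ ‖weightedN σ α κ (z / t) (w / t) (t * (z / t) / h) ((√t / h : ℝ)) ((m / t : ℝ))‖ := by
    rcases le_or_gt (L / t) (δ / 2) with hcase | hcase
    · refine H α κ₀ θ hq 0 (L / h) (by simp) hy (Or.inl rfl) κ _ _ _ _ _ (by linarith) ?_ ?_
        (by linarith) ?_ ee
      · have := norm_add_le (z / t - (L / t : ℝ) * θ) ((L / t : ℝ) * θ)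
        rw [norm_mul, hθ, Complex.norm_of_nonneg hx.1] at this
        simp only [sub_add_cancel] at this
        simp only [Complex.ofReal_zero, zero_mul, sub_zero]
        linarith
      · have := norm_sub_le (w / t - (1 - (L / t : ℝ))) ((L / t : ℝ))
        rw [Complex.norm_of_nonneg hx.1,
          show w / t - (1 - ((L / t : ℝ) : ℂ)) - (L / t : ℝ) = w / t - 1 by ring] at this
        simp only [Complex.ofReal_zero, sub_zero]
        linarith
      · rw [er]; push_cast; simp [hδ.le]
    · have hcase2 : 1 - L / h ≤ δ / 2 := by
        by_contra! h'
        nlinarith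
      refine H α κ₀ θ hq (L / t) 1 hx (by simp) (Or.inr rfl) κ _ _ _ _ _ (by linarith)
        (by linarith) (by linarith) ?_ ?_ ee
      · have := norm_sub_le (t * (z / t) / h - (L / h : ℝ) * θ) (((1 - L / h : ℝ)) * θ)
        rw [norm_mul, hθ, Complex.norm_of_nonneg (sub_nonneg.2 hy.2),
          show t * (z / t) / h - (L / h : ℝ) * θ - ((1 - L / h : ℝ)) * θ =
            t * (z / t) / h - (1 : ℝ) * θ by push_cast; ring] at this
        linarith
      · rw [er, Complex.ofReal_one, sub_self, sub_zero,
          Complex.norm_of_nonneg (sub_nonneg.2 hy.2)]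
        linarith
  have hreg := key.1.scale ht0
  rw [ezt, ewt] at hreg hN
  refine ⟨hreg, ?_⟩
  rw [hN, norm_mul, norm_mul, Complex.norm_of_nonneg ht0.le, Complex.norm_of_nonneg hh0.le]
  rw [ezt] at key
  calc c * (h * t) = t * h * c := by ring
    _ ≤ _ := by gcongr; exact key.2

/-! ### Cauchy estimates for functions of |ξ'|² -/

section

lemma iteratedDeriv_comp_ofReal {g : ℂ → ℂ} {U : Set ℂ} (hU : IsOpen U)
    (hg : AnalyticOnNhd ℂ g U) (n : ℕ) : ∀ x : ℝ, (x : ℂ) ∈ U →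
      iteratedDeriv n (fun y : ℝ => g y) x = iteratedDeriv n g x := by
  induction n with
  | zero => intro x _; simp
  | succ n ih =>
    intro x hx
    rw [iteratedDeriv_succ, iteratedDeriv_succ]
    have hV : ∀ᶠ y : ℝ in 𝓝 x, (y : ℂ) ∈ U :=
      Complex.continuous_ofReal.continuousAt.eventually_mem (hU.mem_nhds hx)
    have he : iteratedDeriv n (fun y : ℝ => g y) =ᶠ[𝓝 x] fun y : ℝ => iteratedDeriv n g y :=
      hV.mono fun y hy => ih y hy
    rw [he.deriv_eq]
    have hd : DifferentiableAt ℂ (iteratedDeriv n g) x := by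
      rw [iteratedDeriv_eq_iterate]
      exact ((hg x hx).iterated_deriv n).differentiableAt
    exact hd.hasDerivAt.comp_ofReal.deriv

variable {V : Type*} [NormedAddCommGroup V] [InnerProductSpace ℝ V]

/-- The bound reads √t, 1 and something positive at orders 0, 1 and above. In this form the products
in the Leibniz rule for ⟨η, η⟩ do not depend on how the derivatives are split. -/
lemma norm_iteratedFDeriv_id_le {t : ℝ} (ht : 0 < t) {ξ : V} (hξ : ‖ξ‖ ^ 2 ≤ t) (n : ℕ) :
    ‖iteratedFDeriv ℝ n (fun η : V => η) ξ‖ ≤ √t * (1 / √t) ^ n := by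
  have hs : 0 < √t := Real.sqrt_pos.2 ht
  rcases n with _ | n
  · simpa using Real.le_sqrt_of_sq_le hξ
  rw [← norm_iteratedFDeriv_fderiv]
  have h1 : fderiv ℝ (fun η : V => η) = fun _ => ContinuousLinearMap.id ℝ V := by
    funext x; exact fderiv_fun_id
  rw [h1]
  rcases n with _ | n
  · have : √t * (√t)⁻¹ = 1 := mul_inv_cancel₀ hs.ne'
    simpa [this] using (ContinuousLinearMap.norm_id_le : ‖ContinuousLinearMap.id ℝ V‖ ≤ 1)
  · rw [iteratedFDeriv_const_of_ne (Nat.succ_ne_zero n)]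
    simp only [Pi.zero_apply, norm_zero]
    positivity

lemma norm_iteratedFDeriv_normSq_div_le {t : ℝ} (ht : 0 < t) {ξ : V} (hξ : ‖ξ‖ ^ 2 ≤ t) (n : ℕ) :
    ‖iteratedFDeriv ℝ n (fun η : V => ‖η‖ ^ 2 / t) ξ‖ ≤ (2 / √t) ^ n := by
  have hs : 0 < √t := Real.sqrt_pos.2 ht
  have h1 : (fun η : V => ‖η‖ ^ 2 / t) = fun η => t⁻¹ • (innerSL ℝ η η) := by
    funext η
    rw [innerSL_apply_apply, real_inner_self_eq_norm_sq, smul_eq_mul]; ring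
  have hsm : ContDiff ℝ n (fun η : V => innerSL ℝ η η) :=
    (innerSL ℝ).contDiff.clm_apply contDiff_id
  have h2 := (innerSL ℝ (E := V)).norm_iteratedFDeriv_le_of_bilinear_of_le_one
    (f := fun η : V => η) (g := fun η : V => η) (N := n) contDiff_id contDiff_id ξ le_rfl
    (norm_innerSL_le ℝ)
  rw [h1, iteratedFDeriv_const_smul_apply' hsm.contDiffAt, norm_smul, norm_inv,
    Real.norm_of_nonneg ht.le]
  have h3 : ∑ i ∈ Finset.range (n + 1), (n.choose i : ℝ) *
      ‖iteratedFDeriv ℝ i (fun η : V => η) ξ‖ * ‖iteratedFDeriv ℝ (n - i) (fun η : V => η) ξ‖ ≤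
      ∑ i ∈ Finset.range (n + 1), (n.choose i : ℝ) * (t * (1 / √t) ^ n) := by
    refine Finset.sum_le_sum fun i hi => ?_
    have hi' : i ≤ n := Nat.lt_succ_iff.1 (Finset.mem_range.1 hi)
    have e : t * (1 / √t) ^ n = (√t * (1 / √t) ^ i) * (√t * (1 / √t) ^ (n - i)) := by
      rw [mul_mul_mul_comm, Real.mul_self_sqrt ht.le, ← pow_add, Nat.add_sub_cancel' hi']
    rw [e, mul_assoc]
    gcongr
    · exact norm_iteratedFDeriv_id_le ht hξ i
    · exact norm_iteratedFDeriv_id_le ht hξ (n - i)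
  rw [← Finset.sum_mul] at h3
  have h4 : (∑ i ∈ Finset.range (n + 1), (n.choose i : ℝ)) = 2 ^ n := by
    exact_mod_cast Nat.sum_range_choose n
  rw [h4] at h3
  calc t⁻¹ * _ ≤ t⁻¹ * (2 ^ n * (t * (1 / √t) ^ n)) := by gcongr; exact h2.trans h3
    _ = (2 / √t) ^ n := by
      rw [div_pow, div_pow, one_pow]; field_simp

/-- Cauchy's estimates for a holomorphic function of `‖η‖²`. -/
theorem norm_iteratedFDeriv_comp_normSq_le {g : ℂ → ℂ} {ξ : V} {t δ M : ℝ} (ht : 0 < t)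
    (hξ : ‖ξ‖ ^ 2 ≤ t) (hδ : 0 < δ) (hδ2 : δ ≤ 2)
    (hg : DifferentiableOn ℂ g (ball ((‖ξ‖ ^ 2 : ℝ) : ℂ) (δ * t)))
    (hM : ∀ w ∈ ball ((‖ξ‖ ^ 2 : ℝ) : ℂ) (δ * t), ‖g w‖ ≤ M) (n : ℕ) :
    ‖iteratedFDeriv ℝ n (fun η : V => g ((‖η‖ ^ 2 : ℝ) : ℂ)) ξ‖ ≤
      n.factorial * (n.factorial * M * (2 / δ) ^ n) * (2 / √t) ^ n := by
  have htC : (t : ℂ) ≠ 0 := by exact_mod_cast ht.ne'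
  -- Rescaling by t turns the disc into one of radius δ, so the bounds for G are free of t; all
  -- dependence on t sits in the inner function ‖η‖²/t.
  let c : ℂ := ((‖ξ‖ ^ 2 / t : ℝ) : ℂ)
  let G : ℂ → ℂ := fun u => g (t * u)
  have hmap : ∀ u ∈ ball c δ, (t : ℂ) * u ∈ ball ((‖ξ‖ ^ 2 : ℝ) : ℂ) (δ * t) := by
    intro u hu
    rw [mem_ball, dist_eq_norm] at hu ⊢
    have : (t : ℂ) * u - ((‖ξ‖ ^ 2 : ℝ) : ℂ) = t * (u - c) := by
      simp only [c]; push_cast; field_simp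
    rw [this, norm_mul, Complex.norm_of_nonneg ht.le, mul_comm δ]
    gcongr
  have hG : DifferentiableOn ℂ G (ball c δ) :=
    hg.comp (by fun_prop) hmap
  have hGa : AnalyticOnNhd ℂ G (ball c δ) := hG.analyticOnNhd isOpen_ball
  have hM0 : 0 ≤ M := (norm_nonneg _).trans (hM _ (mem_ball_self (by positivity)))
  -- Radius δ/2 keeps the circle inside the open disc. Since 2/δ ≥ 1, the bound of order n serves
  -- all orders i ≤ n, as the estimate for compositions requires.
  have hcauchy : ∀ i ≤ n, ‖iteratedDeriv i G c‖ ≤ n.factorial * M * (2 / δ) ^ n := by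
    intro i hi
    have h1 := Complex.norm_iteratedDeriv_le_of_forall_mem_sphere_norm_le (c := c) (R := δ / 2)
      (C := M) (f := G) i (by positivity)
      (hG.diffContOnCl_ball (closedBall_subset_ball (by linarith)))
      (fun u hu => hM _ (hmap u (sphere_subset_closedBall.trans
        (closedBall_subset_ball (by linarith)) hu)))
    have h2 : (1 : ℝ) ≤ 2 / δ := by rw [le_div_iff₀ hδ]; linarith
    calc _ ≤ _ := h1
      _ = i.factorial * M * (2 / δ) ^ i := by rw [div_pow, div_pow]; field_simp
      _ ≤ n.factorial * M * (2 / δ) ^ n := by gcongr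
  let T : Set ℝ := {y | (y : ℂ) ∈ ball c δ}
  have hT : IsOpen T := isOpen_ball.preimage Complex.continuous_ofReal
  let f : V → ℝ := fun η => ‖η‖ ^ 2 / t
  have hf : ContDiff ℝ n f := (contDiff_norm_sq ℝ).div_const t
  let S : Set V := f ⁻¹' T
  have hS : IsOpen S := hT.preimage hf.continuous
  have hξS : ξ ∈ S := mem_ball_self hδ
  have hGc : ContDiffOn ℝ n (fun y : ℝ => G y) T := by
    intro y hy
    have h1 : ContDiffAt ℝ n G (y : ℂ) := ((hGa _ hy).contDiffAt).restrict_scalars ℝ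
    exact (h1.comp y Complex.ofRealCLM.contDiff.contDiffAt).contDiffWithinAt
  have main := norm_iteratedFDerivWithin_comp_le (g := fun y : ℝ => G y) (f := f) (n := n)
    (s := S) (t := T) (x := ξ) (N := n) hGc hf.contDiffOn le_rfl hT.uniqueDiffOn hS.uniqueDiffOn
    (fun _ h => h) hξS (C := n.factorial * M * (2 / δ) ^ n) (D := 2 / √t)
    (by
      intro i hi
      rw [iteratedFDerivWithin_of_isOpen i hT (show f ξ ∈ T from hξS),
        norm_iteratedFDeriv_eq_norm_iteratedDeriv,
        iteratedDeriv_comp_ofReal isOpen_ball hGa i (f ξ) hξS]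
      exact hcauchy i hi)
    (by
      intro i _ _
      rw [iteratedFDerivWithin_of_isOpen i hS hξS]
      exact norm_iteratedFDeriv_normSq_div_le ht hξ i)
  rw [iteratedFDerivWithin_of_isOpen n hS hξS] at main
  have hcomp : (fun y : ℝ => G y) ∘ f = fun η : V => g ((‖η‖ ^ 2 : ℝ) : ℂ) := by
    funext η
    simp only [G, f, Function.comp_apply]
    congr 1
    push_cast
    field_simp
  rwa [hcomp] at main

end

/-! ### The Lopatinski symbol and the derivatives of its inverse -/

section

/-- The value of `κ = α + β + ζ` at `z`. -/
def kappaOf (ν γ₁ γ₃ : ℝ) (Z : ZetaParam) (z : ℂ) : ℂ := ((γ₁⁻¹ * ν : ℝ) : ℂ) + Z.val γ₁ γ₃ z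

lemma analyticAt_kappaOf (ν γ₁ γ₃ : ℝ) (Z : ZetaParam) {z : ℂ} (hz : z ≠ 0) :
    AnalyticAt ℂ (kappaOf ν γ₁ γ₃ Z) z := by
  refine analyticAt_const.add ?_
  cases Z with
  | recip => exact analyticAt_const.mul (analyticAt_id.inv hz)
  | const ζ => exact analyticAt_const

/-- The Lopatinski symbol in terms of `symbHol`. -/
lemma symbN_eq {d : ℕ} {α β σ m : ℝ} {κ ζ z : ℂ} {ξ : EuclideanSpace ℝ (Fin d)}
    (hκ : κ = α + β + ζ) (hz : z ≠ 0) (h : Regular α κ z (xiSq ξ)) :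
    symbN α β ζ z ξ σ m = symbHol σ m α κ z (xiSq ξ) := by
  have hD := h.ne
  have hα := h.ne'
  have hA : symbA α β ζ z ξ = rootSymb (α + κ) z (xiSq ξ) := by
    rw [symbA, rootSymb, hκ]; congr 4; ring
  have hB : symbB α z ξ = rootSymb α z (xiSq ξ) := rfl
  have hA2 := rootSymb_sq (α + κ) z (xiSq ξ)
  have hB2 := rootSymb_sq α z (xiSq ξ)
  have hid := prod_identity (z := z) (w := xiSq ξ) hD hα
  have hray := mul_rayleighQuot h
  have hprod := h.prod
  have hden := h.den
  rw [symbN, lopatinski, Matrix.det_fin_two_of, hA, hB, symbHol, hray, lopFactor]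
  simp only [Matrix.of_apply, Matrix.cons_val', Matrix.cons_val_zero]
  generalize rootSymb (α + κ) z (xiSq ξ) = A at *
  generalize rootSymb α z (xiSq ξ) = B at *
  generalize xiSq ξ = s at *
  have hE : A * B - s ≠ 0 := by
    intro h0
    rw [h0, zero_mul, mul_zero] at hid
    exact mul_ne_zero hz hden hid.symm
  have hfac : α * (α + κ) * (A * B + s) / (z + (2 * α + κ) * s) = z / (A * B - s) := by
    rw [div_eq_div_iff hden hE]
    linear_combination hid
  have hB3 : α * (B ^ 2 - s) = z := by rw [hB2]; field_simp; ring
  have hA3 : (α + κ) * (A ^ 2 - s) = z := by rw [hA2]; field_simp; ring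
  have e1 : (2 * α + β + ζ : ℂ) = α + κ := by rw [hκ]; ring
  have e2 : (β + ζ : ℂ) = κ - α := by rw [hκ]; ring
  have e11 : α * A * (B ^ 2 - s) = A * z := by linear_combination A * hB3
  have e22 : (α + κ) * B * (A ^ 2 - s) = B * z := by linear_combination B * hA3
  have e21 : 2 * α * A * (B - A) - (κ - α) * (A ^ 2 - s) = α * (2 * A * B - s - B ^ 2) := by
    linear_combination hB3 - hA3
  rw [hfac, e1, e2, e11, e22, e21]
  -- Up to the factor s, the two off-diagonal entries agree, and the numerator of the determinant
  -- contains AB - s once: AB(B² - s)² - s(2AB - s - B²)² = (AB - s) R.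
  field_simp
  rw [← hB3]
  ring

variable {d : ℕ} {σ m μ ν γ₁ γ₃ : ℝ} {Z : ZetaParam}

lemma symbNAB_eq {z : ℂ} {ξ : EuclideanSpace ℝ (Fin d)} (hz : z ≠ 0)
    (h : Regular ((γ₁⁻¹ * μ : ℝ) : ℂ) (kappaOf ν γ₁ γ₃ Z z) z (xiSq ξ)) :
    symbNAB σ m μ ν γ₁ γ₃ Z z ξ =
      symbHol σ m ((γ₁⁻¹ * μ : ℝ) : ℂ) (kappaOf ν γ₁ γ₃ Z z) z (xiSq ξ) := by
  refine symbN_eq ?_ hz h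
  rw [kappaOf]; push_cast; ring

/-- The inverse of the symbol as a holomorphic function of `λ` and `|ξ'|²`. -/
def invSymb (σ m μ ν γ₁ γ₃ : ℝ) (Z : ZetaParam) (p : ℂ × ℂ) : ℂ :=
  (symbHol σ m ((γ₁⁻¹ * μ : ℝ) : ℂ) (kappaOf ν γ₁ γ₃ Z p.1) p.1 p.2)⁻¹

lemma analyticAt_invSymb {p : ℂ × ℂ} (hz : p.1 ≠ 0)
    (h : Regular ((γ₁⁻¹ * μ : ℝ) : ℂ) (kappaOf ν γ₁ γ₃ Z p.1) p.1 p.2)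
    (h0 : symbHol σ m ((γ₁⁻¹ * μ : ℝ) : ℂ) (kappaOf ν γ₁ γ₃ Z p.1) p.1 p.2 ≠ 0) :
    AnalyticAt ℂ (invSymb σ m μ ν γ₁ γ₃ Z) p := by
  have hz1 : AnalyticAt ℂ (fun q : ℂ × ℂ => q.1) p := analyticAt_fst
  have hw1 : AnalyticAt ℂ (fun q : ℂ × ℂ => q.2) p := analyticAt_snd
  have hα : AnalyticAt ℂ (fun _ : ℂ × ℂ => ((γ₁⁻¹ * μ : ℝ) : ℂ)) p := analyticAt_const
  have hκ : AnalyticAt ℂ (fun q : ℂ × ℂ => kappaOf ν γ₁ γ₃ Z q.1) p :=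
    (analyticAt_kappaOf ν γ₁ γ₃ Z hz).fun_comp hz1
  have h1 := Regular.analyticAt_lopFactor hα hκ hz1 hw1 h
  have h2 := Regular.analyticAt_rayleighQuot hα hκ hz1 hw1 h
  have h3 := (Regular.analyticAt_root hα hκ hz1 hw1 h).1
  refine AnalyticAt.inv ?_ h0
  unfold symbHol
  fun_prop

/-- The symbol is regular and bounded below by `b` on a complex neighbourhood of
`(lam, ‖ξ‖²)`, of relative size `δ`. -/
def LowerBoundNear (σ m μ ν γ₁ γ₃ : ℝ) (Z : ZetaParam) (lam : ℂ) (s δ b : ℝ) : Prop :=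
  ∀ z w : ℂ, ‖z - lam‖ ≤ δ * ‖lam‖ → ‖w - s‖ ≤ δ * (‖lam‖ + s) →
    Regular ((γ₁⁻¹ * μ : ℝ) : ℂ) (kappaOf ν γ₁ γ₃ Z z) z w ∧
    b ≤ ‖symbHol σ m ((γ₁⁻¹ * μ : ℝ) : ℂ) (kappaOf ν γ₁ γ₃ Z z) z w‖

section Local

variable {lam : ℂ} {ξ : EuclideanSpace ℝ (Fin d)} {δ b : ℝ}

lemma ne_zero_of_near (hlam : lam ≠ 0) (hδ2 : δ ≤ 1 / 2) {z : ℂ}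
    (hz : ‖z - lam‖ ≤ δ * ‖lam‖) : z ≠ 0 := by
  rintro rfl
  have : 0 < ‖lam‖ := norm_pos_iff.2 hlam
  rw [zero_sub, norm_neg] at hz
  nlinarith

variable {s : ℝ} (hlam : lam ≠ 0) (hδ : 0 < δ) (hδ2 : δ ≤ 1 / 2) (hb : 0 < b)

include hlam hδ2 hb in
lemma LowerBoundNear.analyticAt (H : LowerBoundNear σ m μ ν γ₁ γ₃ Z lam s δ b) {z w : ℂ}
    (hz : ‖z - lam‖ ≤ δ * ‖lam‖) (hw : ‖w - s‖ ≤ δ * (‖lam‖ + s)) :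
    AnalyticAt ℂ (invSymb σ m μ ν γ₁ γ₃ Z) (z, w) := by
  obtain ⟨h1, h2⟩ := H z w hz hw
  exact analyticAt_invSymb (p := (z, w)) (ne_zero_of_near hlam hδ2 hz) h1
    (norm_pos_iff.1 (hb.trans_le h2))

include hb in
lemma LowerBoundNear.norm_invSymb_le (H : LowerBoundNear σ m μ ν γ₁ γ₃ Z lam s δ b) {z w : ℂ}
    (hz : ‖z - lam‖ ≤ δ * ‖lam‖) (hw : ‖w - s‖ ≤ δ * (‖lam‖ + s)) :
    ‖invSymb σ m μ ν γ₁ γ₃ Z (z, w)‖ ≤ 1 / b := by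
  obtain ⟨h1, h2⟩ := H z w hz hw
  rw [invSymb, norm_inv, ← one_div]
  exact one_div_le_one_div_of_le hb h2

include hlam hδ hδ2 hb in
-- Cauchy's estimate on the circle of radius δ|λ|. The radius is proportional to |λ|, so the factor
-- τ of τ∂_τ is absorbed by |τ| ≤ |λ|.
lemma LowerBoundNear.norm_deriv_le (H : LowerBoundNear σ m μ ν γ₁ γ₃ Z lam s δ b) {w : ℂ}
    (hw : ‖w - s‖ ≤ δ * (‖lam‖ + s)) :
    ‖deriv (fun z => invSymb σ m μ ν γ₁ γ₃ Z (z, w)) lam‖ ≤ 1 / b / (δ * ‖lam‖) := by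
  have hl : 0 < ‖lam‖ := norm_pos_iff.2 hlam
  have hR : 0 < δ * ‖lam‖ := by positivity
  refine Complex.norm_deriv_le_of_forall_mem_sphere_norm_le hR ?_ ?_
  · refine DifferentiableOn.diffContOnCl_ball (U := closedBall lam (δ * ‖lam‖)) ?_ subset_rfl
    intro z hz
    rw [mem_closedBall, dist_eq_norm] at hz
    have h1 := (H.analyticAt hlam hδ2 hb hz hw).differentiableAt
    have h2 : DifferentiableAt ℂ (fun z : ℂ => (z, w)) z := by fun_prop
    exact (h1.comp z h2).differentiableWithinAt
  · intro z hz
    rw [mem_sphere, dist_eq_norm] at hz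
    exact H.norm_invSymb_le hb hz.le hw

include hlam hδ2 hb hδ in
-- The z-derivative is the full derivative of a jointly analytic function in the direction (1, 0),
-- hence holomorphic in w. This allows Cauchy's estimates in w after τ∂_τ has been applied.
lemma LowerBoundNear.differentiableAt_deriv (H : LowerBoundNear σ m μ ν γ₁ γ₃ Z lam s δ b) {w : ℂ}
    (hw : ‖w - s‖ < δ * (‖lam‖ + s)) :
    DifferentiableAt ℂ (fun w => deriv (fun z => invSymb σ m μ ν γ₁ γ₃ Z (z, w)) lam) w := by
  have hz : ‖lam - lam‖ ≤ δ * ‖lam‖ := by rw [sub_self, norm_zero]; positivity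
  have hder : ∀ v : ℂ, ‖v - s‖ < δ * (‖lam‖ + s) →
      fderiv ℂ (invSymb σ m μ ν γ₁ γ₃ Z) (lam, v) (1, 0) =
        deriv (fun z => invSymb σ m μ ν γ₁ γ₃ Z (z, v)) lam := by
    intro v hv
    have h1 := (H.analyticAt hlam hδ2 hb hz hv.le).differentiableAt.hasFDerivAt
    have h2 : HasDerivAt (fun z : ℂ => (z, v)) ((1 : ℂ), (0 : ℂ)) lam :=
      (hasDerivAt_id lam).prodMk (hasDerivAt_const lam v)
    exact (h1.comp_hasDerivAt lam h2).deriv.symm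
  have hev : (fun v => fderiv ℂ (invSymb σ m μ ν γ₁ γ₃ Z) (lam, v) (1, 0)) =ᶠ[𝓝 w]
      fun v => deriv (fun z => invSymb σ m μ ν γ₁ γ₃ Z (z, v)) lam := by
    have : ∀ᶠ v : ℂ in 𝓝 w, ‖v - s‖ < δ * (‖lam‖ + s) :=
      ContinuousAt.eventually_lt (by fun_prop) continuousAt_const hw
    exact this.mono hder
  refine DifferentiableAt.congr_of_eventuallyEq ?_ hev.symm
  have h1 := (H.analyticAt hlam hδ2 hb hz hw.le).fderiv.differentiableAt
  have h2 : DifferentiableAt ℂ (fun v : ℂ => (lam, v)) w := by fun_prop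
  exact (h1.comp w h2).clm_apply (differentiableAt_const _)

lemma LowerBoundNear.inv_symbNAB_eq
    (H : LowerBoundNear σ m μ ν γ₁ γ₃ Z lam s δ b) (hlam : lam ≠ 0) (hδ2 : δ ≤ 1 / 2) {z : ℂ}
    (hz : ‖z - lam‖ ≤ δ * ‖lam‖)
    {η : EuclideanSpace ℝ (Fin d)} (hη : ‖((‖η‖ ^ 2 : ℝ) : ℂ) - s‖ ≤ δ * (‖lam‖ + s)) :
    (symbNAB σ m μ ν γ₁ γ₃ Z z η)⁻¹ = invSymb σ m μ ν γ₁ γ₃ Z (z, ((‖η‖ ^ 2 : ℝ) : ℂ)) := by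
  rw [symbNAB_eq (ne_zero_of_near hlam hδ2 hz) (H z _ hz hη).1]
  rfl

lemma norm_sq_sub_self (ξ : EuclideanSpace ℝ (Fin d)) :
    ‖((‖ξ‖ ^ 2 : ℝ) : ℂ) - ((‖ξ‖ ^ 2 : ℝ) : ℂ)‖ = 0 := by rw [sub_self, norm_zero]

include hlam hδ in
lemma eventually_normSq_near :
    ∀ᶠ η : EuclideanSpace ℝ (Fin d) in 𝓝 ξ,
      ‖((‖η‖ ^ 2 : ℝ) : ℂ) - ((‖ξ‖ ^ 2 : ℝ) : ℂ)‖ < δ * (‖lam‖ + ‖ξ‖ ^ 2) := by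
  have hl : 0 < ‖lam‖ := norm_pos_iff.2 hlam
  refine ContinuousAt.eventually_lt ?_ continuousAt_const (by rw [norm_sq_sub_self]; positivity)
  exact ((Complex.continuous_ofReal.comp (continuous_norm.pow 2)).sub
    continuous_const).norm.continuousAt

include hlam hδ in
lemma eventually_near : ∀ᶠ z in 𝓝 lam, ‖z - lam‖ < δ * ‖lam‖ := by
  have hl : 0 < ‖lam‖ := norm_pos_iff.2 hlam
  refine ContinuousAt.eventually_lt (by fun_prop) continuousAt_const ?_
  rw [sub_self, norm_zero]; positivity

include hlam hδ in
theorem LowerBoundNear.le_norm_symbNAB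
    (H : LowerBoundNear σ m μ ν γ₁ γ₃ Z lam (‖ξ‖ ^ 2) δ b) :
    b ≤ ‖symbNAB σ m μ ν γ₁ γ₃ Z lam ξ‖ := by
  have h1 : ‖lam - lam‖ ≤ δ * ‖lam‖ := by rw [sub_self, norm_zero]; positivity
  have h2 : ‖((‖ξ‖ ^ 2 : ℝ) : ℂ) - ((‖ξ‖ ^ 2 : ℝ) : ℂ)‖ ≤ δ * (‖lam‖ + ‖ξ‖ ^ 2) := by
    rw [norm_sq_sub_self]; positivity
  have h3 := H lam _ h1 h2
  rw [symbNAB_eq hlam h3.1]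
  exact h3.2

include hlam hδ hδ2 hb in
theorem LowerBoundNear.contDiffAt
    (H : LowerBoundNear σ m μ ν γ₁ γ₃ Z lam (‖ξ‖ ^ 2) δ b) :
    ContDiffAt ℝ ∞ (fun p : ℂ × EuclideanSpace ℝ (Fin d) =>
      (symbNAB σ m μ ν γ₁ γ₃ Z p.1 p.2)⁻¹) (lam, ξ) := by
  have h1 : ‖lam - lam‖ ≤ δ * ‖lam‖ := by rw [sub_self, norm_zero]; positivity
  have h2 : ‖((‖ξ‖ ^ 2 : ℝ) : ℂ) - ((‖ξ‖ ^ 2 : ℝ) : ℂ)‖ ≤ δ * (‖lam‖ + ‖ξ‖ ^ 2) := by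
    rw [norm_sq_sub_self]; positivity
  have hG : ContDiffAt ℝ ∞ (invSymb σ m μ ν γ₁ γ₃ Z) (lam, ((‖ξ‖ ^ 2 : ℝ) : ℂ)) :=
    (H.analyticAt hlam hδ2 hb h1 h2).contDiffAt.restrict_scalars ℝ
  have hmap : ContDiff ℝ ∞ (fun p : ℂ × EuclideanSpace ℝ (Fin d) =>
      (p.1, ((‖p.2‖ ^ 2 : ℝ) : ℂ))) :=
    contDiff_fst.prodMk
      (Complex.ofRealCLM.contDiff.comp ((contDiff_norm_sq ℝ).comp contDiff_snd))
  have hcomp := ContDiffAt.comp (lam, ξ) hG hmap.contDiffAt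
  refine hcomp.congr_of_eventuallyEq ?_
  have e1 := (continuous_fst.tendsto (lam, ξ)).eventually (eventually_near hlam hδ)
  have e2 := (continuous_snd.tendsto (lam, ξ)).eventually
    (eventually_normSq_near (ξ := ξ) hlam hδ)
  filter_upwards [e1, e2] with p hp1 hp2
  exact H.inv_symbNAB_eq hlam hδ2 hp1.le hp2.le

/-- `τ ∂_τ` in terms of the complex derivative. -/
lemma tauDeriv_eq {F : ℂ → ℂ} {z : ℂ} (hF : DifferentiableAt ℂ F z) :
    tauDeriv F z = z.im * (deriv F z * Complex.I) := by
  have hz : (z.re : ℂ) + z.im * Complex.I = z := Complex.re_add_im z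
  have h1 : HasDerivAt (fun τ : ℝ => (z.re : ℂ) + τ * Complex.I) Complex.I z.im := by
    have := ((hasDerivAt_id z.im).ofReal_comp.mul_const Complex.I).const_add (z.re : ℂ)
    simpa using this
  have h2 : HasDerivAt F (deriv F z) ((z.re : ℂ) + z.im * Complex.I) := by
    rw [hz]; exact hF.hasDerivAt
  have h3 : deriv (fun τ : ℝ => F (z.re + τ * Complex.I)) z.im = deriv F z * Complex.I :=
    (h2.comp z.im h1).deriv
  rw [tauDeriv, h3]

include hlam hδ hδ2 hb in
theorem LowerBoundNear.norm_iteratedFDeriv_le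
    (H : LowerBoundNear σ m μ ν γ₁ γ₃ Z lam (‖ξ‖ ^ 2) δ b) (n : ℕ) {ℓ : ℕ} (hℓ : ℓ ≤ 1) :
    ‖iteratedFDeriv ℝ n (fun η : EuclideanSpace ℝ (Fin d) =>
      tauDeriv^[ℓ] (fun z => (symbNAB σ m μ ν γ₁ γ₃ Z z η)⁻¹) lam) ξ‖ ≤
      n.factorial * (n.factorial * (1 / (b * δ)) * (2 / δ) ^ n) *
        (2 / √(‖lam‖ + ‖ξ‖ ^ 2)) ^ n := by
  have hl : 0 < ‖lam‖ := norm_pos_iff.2 hlam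
  have h1 : ‖lam - lam‖ ≤ δ * ‖lam‖ := by rw [sub_self, norm_zero]; positivity
  have hev := eventually_normSq_near (ξ := ξ) hlam hδ
  have ht : 0 < ‖lam‖ + ‖ξ‖ ^ 2 := by positivity
  have ht' : ‖ξ‖ ^ 2 ≤ ‖lam‖ + ‖ξ‖ ^ 2 := by linarith
  obtain rfl | rfl : ℓ = 0 ∨ ℓ = 1 := by omega
  · have he : (fun η : EuclideanSpace ℝ (Fin d) =>
        tauDeriv^[0] (fun z => (symbNAB σ m μ ν γ₁ γ₃ Z z η)⁻¹) lam) =ᶠ[𝓝 ξ]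
        fun η => (fun w => invSymb σ m μ ν γ₁ γ₃ Z (lam, w)) ((‖η‖ ^ 2 : ℝ) : ℂ) := by
      filter_upwards [hev] with η hη
      exact H.inv_symbNAB_eq hlam hδ2 h1 hη.le
    rw [(Filter.EventuallyEq.iteratedFDeriv ℝ he n).eq_of_nhds]
    refine norm_iteratedFDeriv_comp_normSq_le
      (g := fun w => invSymb σ m μ ν γ₁ γ₃ Z (lam, w)) ht ht' hδ (by linarith) ?_ ?_ n
    · intro w hw
      rw [mem_ball, dist_eq_norm] at hw
      have h3 := (H.analyticAt hlam hδ2 hb h1 hw.le).differentiableAt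
      have h4 : DifferentiableAt ℂ (fun w : ℂ => (lam, w)) w := by fun_prop
      exact (h3.comp w h4).differentiableWithinAt
    · intro w hw
      rw [mem_ball, dist_eq_norm] at hw
      refine (H.norm_invSymb_le hb h1 hw.le).trans ?_
      -- 1/b is weakened to 1/(bδ), using δ ≤ 1, so that one constant serves ℓ = 0 and ℓ = 1.
      refine one_div_le_one_div_of_le (by positivity) ?_
      nlinarith
  · have he : (fun η : EuclideanSpace ℝ (Fin d) =>
        tauDeriv^[1] (fun z => (symbNAB σ m μ ν γ₁ γ₃ Z z η)⁻¹) lam) =ᶠ[𝓝 ξ]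
        fun η => (fun w => lam.im * (deriv (fun z => invSymb σ m μ ν γ₁ γ₃ Z (z, w)) lam
          * Complex.I)) ((‖η‖ ^ 2 : ℝ) : ℂ) := by
      filter_upwards [hev] with η hη
      have e1 : (fun z => (symbNAB σ m μ ν γ₁ γ₃ Z z η)⁻¹) =ᶠ[𝓝 lam]
          fun z => invSymb σ m μ ν γ₁ γ₃ Z (z, ((‖η‖ ^ 2 : ℝ) : ℂ)) := by
        filter_upwards [eventually_near hlam hδ] with z hz
        exact H.inv_symbNAB_eq hlam hδ2 hz.le hη.le
      have h3 := (H.analyticAt hlam hδ2 hb h1 hη.le).differentiableAt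
      have h4 : DifferentiableAt ℂ (fun z : ℂ => (z, ((‖η‖ ^ 2 : ℝ) : ℂ))) lam := by fun_prop
      have h5 := (h3.comp lam h4).congr_of_eventuallyEq e1
      rw [Function.iterate_one, tauDeriv_eq h5, e1.deriv_eq]
    rw [(Filter.EventuallyEq.iteratedFDeriv ℝ he n).eq_of_nhds]
    refine norm_iteratedFDeriv_comp_normSq_le
      (g := fun w => lam.im * (deriv (fun z => invSymb σ m μ ν γ₁ γ₃ Z (z, w)) lam
          * Complex.I)) ht ht' hδ (by linarith) ?_ ?_ n
    · intro w hw
      rw [mem_ball, dist_eq_norm] at hw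
      exact (((H.differentiableAt_deriv hlam hδ hδ2 hb hw).mul_const _).const_mul
        _).differentiableWithinAt
    · intro w hw
      rw [mem_ball, dist_eq_norm] at hw
      have h3 := H.norm_deriv_le hlam hδ hδ2 hb hw.le
      rw [norm_mul, norm_mul, Complex.norm_I, mul_one, Complex.norm_real, Real.norm_eq_abs]
      calc |lam.im| * _ ≤ ‖lam‖ * (1 / b / (δ * ‖lam‖)) := by
            gcongr
            exact Complex.abs_im_le_norm lam
        _ = 1 / (b * δ) := by field_simp

end Local

end

/-! ### Half-planes and compactness for the parameter regions -/

lemma sectorSet_re {ε : ℝ} (hε : 0 < ε) {z : ℂ} (hz : z ∈ sectorSet ε) :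
    -Real.cos ε * ‖z‖ ≤ z.re := by
  have h1 : Real.cos (Real.pi - ε) ≤ Real.cos |z.arg| :=
    Real.cos_le_cos_of_nonneg_of_le_pi (abs_nonneg _) (by linarith) hz.2
  rw [Real.cos_pi_sub, Real.cos_abs] at h1
  rw [← Complex.norm_mul_cos_arg z, mul_comm]
  gcongr

/-- Admissible pairs of a constant `ζ` and a direction `θ = λ / |λ|`. -/
def DirCond (ε : ℝ) (ζ θ : ℂ) : Prop :=
  (ζ = 0 ∧ -Real.cos ε ≤ θ.re) ∨ (0 ≤ ζ.re ∧ 0 ≤ θ.re) ∨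
    (-Real.cos ε * ‖ζ‖ ≤ ζ.re ∧ 0 ≤ θ.re ∧ |ζ.re| * |θ.im| ≤ θ.re * |ζ.im|)

lemma DirCond.conj {ε : ℝ} {ζ θ : ℂ} (h : DirCond ε ζ θ) : DirCond ε (conj ζ) θ := by
  rcases h with ⟨h1, h2⟩ | ⟨h1, h2⟩ | ⟨h1, h2, h3⟩
  · exact Or.inl ⟨by rw [h1, map_zero], h2⟩
  · exact Or.inr (Or.inl ⟨by simpa using h1, h2⟩)
  · exact Or.inr (Or.inr ⟨by simpa using h1, h2, by simpa using h3⟩)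

/-- Adding η times the conjugate of θ to χ increases Re(χθ) by exactly η, because |θ| = 1; η is
small enough to preserve the other two strict inequalities. -/
lemma exists_strict_half {χ θ κ : ℂ} (hθ : ‖θ‖ = 1) (h1 : 0 < χ.re) (h2 : 0 ≤ (χ * θ).re)
    (h3 : 0 < (χ * κ).re) : ∃ χ' : ℂ, 0 < χ'.re ∧ 0 < (χ' * θ).re ∧ 0 < (χ' * κ).re := by
  obtain ⟨η, hη⟩ : ∃ η, η = min χ.re (χ * κ).re / (2 * (1 + ‖κ‖)) := ⟨_, rfl⟩
  have hmin : 0 < min χ.re (χ * κ).re := lt_min h1 h3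
  have hη0 : 0 < η := by rw [hη]; positivity
  have hη1 : η * (1 + ‖κ‖) < min χ.re (χ * κ).re := by
    rw [hη]; field_simp; linarith
  have hκ := norm_nonneg κ
  have hl := min_le_left χ.re (χ * κ).re
  have hr := min_le_right χ.re (χ * κ).re
  have b1 : -1 ≤ θ.re := by
    have := Complex.abs_re_le_norm θ
    rw [hθ] at this
    exact (abs_le.1 this).1
  have b2 : -‖κ‖ ≤ (conj θ * κ).re := by
    have := Complex.abs_re_le_norm (conj θ * κ)
    rw [norm_mul, Complex.norm_conj, hθ, one_mul] at this
    exact (abs_le.1 this).1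
  have b3 : (conj θ * θ).re = 1 := by
    rw [mul_comm, Complex.mul_conj', hθ]; simp
  refine ⟨χ + η * conj θ, ?_, ?_, ?_⟩
  · rw [Complex.add_re, Complex.re_ofReal_mul, Complex.conj_re]
    nlinarith
  · rw [add_mul, mul_assoc, Complex.add_re, Complex.re_ofReal_mul, b3]
    linarith
  · rw [add_mul, mul_assoc, Complex.add_re, Complex.re_ofReal_mul]
    nlinarith

/-- Before tilting, χ is 1 + θ̄ when ζ = 0, and 1 when Re ζ ≥ 0 and Re θ ≥ 0. When Re ζ < 0 it is i
(Im ζ) ζ̄: then χζ is purely imaginary and Re(χ(p + ζ)) = p (Im ζ)², while Re(χθ) ≥ 0 is the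
inequality that defines the region in (C2). -/
lemma DirCond.exists_half {ε p : ℝ} {ζ θ : ℂ} (hε : 0 < ε) (hε' : ε < Real.pi / 2) (hp : 0 < p)
    (hθ : ‖θ‖ = 1) (h : DirCond ε ζ θ) :
    ∃ χ : ℂ, 0 < χ.re ∧ 0 < (χ * θ).re ∧ 0 < (χ * (p + ζ)).re := by
  have hcos : Real.cos ε < 1 := by
    have := Real.cos_lt_cos_of_nonneg_of_le_pi_div_two le_rfl hε'.le hε
    rwa [Real.cos_zero] at this
  have caseC3 : 0 ≤ ζ.re → 0 ≤ θ.re →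
      ∃ χ : ℂ, 0 < χ.re ∧ 0 < (χ * θ).re ∧ 0 < (χ * (p + ζ)).re := by
    intro h1 h2
    refine exists_strict_half hθ (χ := 1) (by simp) (by simpa using h2) ?_
    simp only [one_mul, Complex.add_re, Complex.ofReal_re]
    linarith
  rcases h with ⟨rfl, h2⟩ | ⟨h1, h2⟩ | ⟨h1, h2, h3⟩
  · have h4 : 0 < 1 + θ.re := by linarith
    refine exists_strict_half hθ (χ := 1 + conj θ) (by simpa using h4) ?_ ?_
    · rw [add_mul, one_mul, mul_comm (conj θ), Complex.mul_conj', hθ]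
      simp only [Complex.add_re, Complex.ofReal_one, one_pow, Complex.one_re]
      linarith
    · rw [add_zero, Complex.re_mul_ofReal]
      simp only [Complex.add_re, Complex.one_re, Complex.conj_re]
      positivity
  · exact caseC3 h1 h2
  · rcases le_or_gt 0 ζ.re with hre | hre
    · exact caseC3 hre h2
    have him : ζ.im ≠ 0 := by
      intro h0
      have hn : ‖ζ‖ = -ζ.re := by
        have : ζ = (ζ.re : ℂ) := Complex.ext (by simp) (by simp [h0])
        rw [this, Complex.norm_real, Real.norm_eq_abs, Complex.ofReal_re, abs_of_neg hre]
      rw [hn] at h1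
      nlinarith
    have hsq : 0 < ζ.im ^ 2 := by positivity
    refine exists_strict_half hθ (χ := ⟨ζ.im ^ 2, ζ.im * ζ.re⟩) hsq ?_ ?_
    · rw [Complex.mul_re]
      have h5 : ζ.im * ζ.re * θ.im ≤ |ζ.im| * (|ζ.re| * |θ.im|) := by
        rw [← abs_mul, ← abs_mul, ← mul_assoc]
        exact le_abs_self _
      have h6 : |ζ.im| * (|ζ.re| * |θ.im|) ≤ |ζ.im| * (θ.re * |ζ.im|) := by gcongr
      have h7 : |ζ.im| * |ζ.im| = ζ.im ^ 2 := by rw [abs_mul_abs_self, sq]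
      have h8 : |ζ.im| * (θ.re * |ζ.im|) = ζ.im ^ 2 * θ.re := by rw [← h7]; ring
      simp only
      linarith
    · rw [Complex.mul_re]
      simp only [Complex.add_re, Complex.ofReal_re, Complex.add_im, Complex.ofReal_im]
      have : ζ.im ^ 2 * (p + ζ.re) - ζ.im * ζ.re * (0 + ζ.im) = p * ζ.im ^ 2 := by ring
      rw [this]
      positivity

/-- The compact set of parameters `(γ₁, ζ, θ)`. -/
def paramSet (ε R ρ₁ ρ₂ : ℝ) : Set (ℝ × ℂ × ℂ) :=
  {p | p.1 ∈ Set.Icc ρ₁ ρ₂ ∧ ‖p.2.1‖ ≤ R ∧ ‖p.2.2‖ = 1 ∧ DirCond ε p.2.1 p.2.2}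

/-- `DirCond` consists of equations and weak inequalities, with the quotient Re ζ / Im ζ of (C2)
cleared of its denominator, so it is a closed condition. -/
lemma isCompact_paramSet (ε R ρ₁ ρ₂ : ℝ) : IsCompact (paramSet ε R ρ₁ ρ₂) := by
  have hc : IsCompact (Set.Icc ρ₁ ρ₂ ×ˢ (closedBall (0 : ℂ) R ×ˢ closedBall (0 : ℂ) 1)) :=
    isCompact_Icc.prod ((isCompact_closedBall _ _).prod (isCompact_closedBall _ _))
  refine hc.of_isClosed_subset ?_ ?_
  · have c1 : Continuous fun p : ℝ × ℂ × ℂ => p.2.1.re := by fun_prop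
    have c2 : Continuous fun p : ℝ × ℂ × ℂ => p.2.2.re := by fun_prop
    have c3 : Continuous fun p : ℝ × ℂ × ℂ => p.2.1.im := by fun_prop
    have c4 : Continuous fun p : ℝ × ℂ × ℂ => p.2.2.im := by fun_prop
    have c5 : Continuous fun p : ℝ × ℂ × ℂ => ‖p.2.1‖ := by fun_prop
    refine (isClosed_Icc.preimage continuous_fst).inter ((isClosed_le c5 continuous_const).inter
      ((isClosed_eq (by fun_prop) continuous_const).inter ?_))
    refine IsClosed.union ?_ (IsClosed.union ?_ ?_)
    · exact (isClosed_eq (by fun_prop) continuous_const).inter (isClosed_le continuous_const c2)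
    · exact (isClosed_le continuous_const c1).inter (isClosed_le continuous_const c2)
    · exact (isClosed_le (continuous_const.mul c5) c1).inter
        ((isClosed_le continuous_const c2).inter
          (isClosed_le (c1.abs.mul c4.abs) (c2.mul c3.abs)))
  · rintro ⟨γ, ζ, θ⟩ ⟨h1, h2, h3, _⟩
    exact ⟨h1, by simpa using h2, by simpa using h3.le⟩

/-- The map `(γ₁, ζ, θ) ↦ (α, κ, θ)`. -/
def paramMap (μ ν : ℝ) (p : ℝ × ℂ × ℂ) : ℝ × ℂ × ℂ :=
  (p.1⁻¹ * μ, ((p.1⁻¹ * ν : ℝ) : ℂ) + p.2.1, p.2.2)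

lemma isCompact_image_paramMap {ε R μ ν ρ₁ ρ₂ : ℝ} (hρ₁ : 0 < ρ₁) :
    IsCompact (paramMap μ ν '' paramSet ε R ρ₁ ρ₂) := by
  refine (isCompact_paramSet ε R ρ₁ ρ₂).image_of_continuousOn ?_
  have hinv : ContinuousOn (fun p : ℝ × ℂ × ℂ => p.1⁻¹) (paramSet ε R ρ₁ ρ₂) :=
    continuousOn_fst.inv₀ fun p hp => (hρ₁.trans_le hp.1.1).ne'
  have h2 : ContinuousOn (fun p : ℝ × ℂ × ℂ => ((p.1⁻¹ * ν : ℝ) : ℂ)) (paramSet ε R ρ₁ ρ₂) :=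
    Complex.continuous_ofReal.comp_continuousOn (hinv.mul continuousOn_const)
  exact (hinv.mul continuousOn_const).prodMk
    ((h2.add (by fun_prop)).prodMk (by fun_prop))

lemma isGood_paramMap {ε R μ ν ρ₁ ρ₂ : ℝ} (hε : 0 < ε) (hε' : ε < Real.pi / 2) (hμ : 0 < μ)
    (hν : 0 < ν) (hρ₁ : 0 < ρ₁) :
    ∀ q ∈ paramMap μ ν '' paramSet ε R ρ₁ ρ₂, IsGood q.1 q.2.1 q.2.2 := by
  rintro _ ⟨⟨γ, ζ, θ⟩, ⟨h1, _, h3, h4⟩, rfl⟩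
  have hγ : 0 < γ := hρ₁.trans_le h1.1
  have hp : 0 < γ⁻¹ * ν := by positivity
  refine ⟨mul_pos (inv_pos.2 hγ) hμ, h3, h4.exists_half hε hε' hp h3, ?_⟩
  have := h4.conj.exists_half hε hε' hp h3
  simp only [paramMap, map_add, Complex.conj_ofReal]
  exact this

/-- The limit, as `|λ| → ∞`, of the parameter `ζ`. -/
def zetaLim : ZetaParam → ℂ
  | ZetaParam.recip => 0
  | ZetaParam.const ζ => ζ

lemma mem_region_spec {ε ζ₀ ν ρ₃ lam₀ : ℝ} (hε : 0 < ε)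
    (hlam₀ : 1 ≤ lam₀) {Z : ZetaParam} (hZ : Z.Admissible ε ζ₀) {lam : ℂ}
    (hlam : lam ∈ Z.region ν ρ₃ ε lam₀) :
    lam₀ ≤ ‖lam‖ ∧ ‖zetaLim Z‖ ≤ max ζ₀ 0 ∧ DirCond ε (zetaLim Z) (lam / ‖lam‖) := by
  have hdivre : (lam / ‖lam‖).re = lam.re / ‖lam‖ := Complex.div_ofReal_re _ _
  have hdivim : (lam / ‖lam‖).im = lam.im / ‖lam‖ := Complex.div_ofReal_im _ _
  cases Z with
  | recip =>
    obtain ⟨⟨hsec, hL⟩, -⟩ := hlam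
    have hpos : 0 < ‖lam‖ := by linarith
    refine ⟨hL, by simp [zetaLim], Or.inl ⟨rfl, ?_⟩⟩
    rw [hdivre, le_div_iff₀ hpos]
    exact sectorSet_re hε hsec
  | const ζ =>
    obtain ⟨hζ, hZ⟩ := hZ
    have hR : ‖ζ‖ ≤ max ζ₀ 0 := hζ.trans (le_max_left _ _)
    by_cases hre : ζ.re < 0
    · simp only [ZetaParam.region, if_pos hre, Set.mem_ofPred_eq] at hlam
      obtain ⟨h1, h2⟩ := hlam
      have hL : lam₀ ≤ ‖lam‖ := h2.trans (Complex.re_le_norm lam)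
      have hpos : 0 < ‖lam‖ := by linarith
      have hsec : ζ ∈ sectorSet ε := by
        rcases hZ with h | h
        · exact h.1
        · exact absurd h (not_le.2 hre)
      refine ⟨hL, hR, Or.inr (Or.inr ⟨sectorSet_re hε hsec, ?_, ?_⟩)⟩
      · rw [hdivre]
        exact div_nonneg (by linarith) hpos.le
      · have him : ζ.im ≠ 0 := by
          intro h0
          have harg : ζ.arg = Real.pi := Complex.arg_eq_pi_iff.2 ⟨hre, h0⟩
          have := hsec.2
          rw [harg, abs_of_pos Real.pi_pos] at this
          linarith
        have him' : 0 < |ζ.im| := abs_pos.2 him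
        rw [abs_div, div_mul_eq_mul_div, div_le_iff₀ him'] at h1
        rw [hdivre, hdivim, abs_div, abs_of_pos hpos, zetaLim]
        calc |ζ.re| * (|lam.im| / ‖lam‖) = |ζ.re| * |lam.im| / ‖lam‖ := by ring
          _ ≤ lam.re * |ζ.im| / ‖lam‖ := by gcongr
          _ = lam.re / ‖lam‖ * |ζ.im| := by ring
    · simp only [ZetaParam.region, if_neg hre, Set.mem_ofPred_eq] at hlam
      have hL : lam₀ ≤ ‖lam‖ := hlam.trans (Complex.re_le_norm lam)
      have hpos : 0 < ‖lam‖ := by linarith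
      refine ⟨hL, hR, Or.inr (Or.inl ⟨not_lt.1 hre, ?_⟩)⟩
      rw [hdivre]
      exact div_nonneg (by linarith) hpos.le

/-- In case (C1), |z| ≥ |λ|/2 makes |ζ(z)| ≤ 2γ₃/(γ₁|λ|), which is at most δ for large λ. Thus (C1)
is reduced to ζ = 0 up to a perturbation that the lower bound tolerates. -/
lemma norm_kappaOf_sub_le {ν γ₁ γ₃ ρ₁ ρ₃ δ : ℝ} (hρ₁ : 0 < ρ₁) (hδ : 0 < δ) (hδ2 : δ ≤ 1 / 2)
    (hγ₁ : ρ₁ ≤ γ₁) (hγ₃ : 0 < γ₃) (hγ₃' : γ₃ ≤ ρ₃) (Z : ZetaParam) {lam z : ℂ} (hlam : lam ≠ 0)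
    (hL : 2 * ρ₃ / (ρ₁ * δ) ≤ ‖lam‖) (hz : ‖z - lam‖ ≤ δ * ‖lam‖) :
    ‖kappaOf ν γ₁ γ₃ Z z - (((γ₁⁻¹ * ν : ℝ) : ℂ) + zetaLim Z)‖ ≤ δ := by
  rw [kappaOf, add_sub_add_left_eq_sub]
  cases Z with
  | const ζ => simpa [ZetaParam.val, zetaLim] using hδ.le
  | recip =>
    have hl : 0 < ‖lam‖ := norm_pos_iff.2 hlam
    have h1 : ‖lam‖ / 2 ≤ ‖z‖ := by
      have := norm_sub_norm_le lam z
      rw [norm_sub_rev] at this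
      nlinarith
    have hz0 : 0 < ‖z‖ := by linarith
    have hγ : 0 < γ₁ := by linarith
    simp only [ZetaParam.val, zetaLim, sub_zero, norm_mul, norm_inv, Complex.norm_real,
      Real.norm_eq_abs, abs_of_pos hγ, abs_of_pos hγ₃]
    rw [div_le_iff₀ (by positivity)] at hL
    rw [← div_eq_mul_inv, inv_mul_eq_div, div_div, div_le_iff₀ (by positivity)]
    calc γ₃ ≤ δ * (ρ₁ * (‖lam‖ / 2)) := by linarith
      _ ≤ δ * (γ₁ * ‖z‖) := by gcongr

theorem exists_lowerBoundNear {ε σ m μ ν ρ₁ : ℝ} (ζ₀ ρ₂ ρ₃ : ℝ)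
    (hε : 0 < ε) (hε' : ε < Real.pi / 2) (hσ : 0 < σ) (hm : 0 < m) (hμ : 0 < μ) (hν : 0 < ν)
    (hρ₁ : 0 < ρ₁) :
    ∃ δ : ℝ, 0 < δ ∧ δ ≤ 1 / 2 ∧ ∃ lam₀ : ℝ, 1 ≤ lam₀ ∧ ∃ c : ℝ, 0 < c ∧
      ∀ (γ₁ γ₃ : ℝ) (Z : ZetaParam), ρ₁ ≤ γ₁ → γ₁ ≤ ρ₂ → 0 < γ₃ → γ₃ ≤ ρ₃ →
        Z.Admissible ε ζ₀ → ∀ lam ∈ Z.region ν ρ₃ ε lam₀, lam ≠ 0 ∧ ∀ s : ℝ, 0 ≤ s →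
        LowerBoundNear σ m μ ν γ₁ γ₃ Z lam s δ
          (c * ((‖lam‖ + √(‖lam‖ + s)) * (‖lam‖ + s))) := by
  obtain ⟨δ, hδ, hδ2, lam₀, hlam₀, c, hc, H⟩ := symbHol_lower_bound
    (isCompact_image_paramMap (ε := ε) (R := max ζ₀ 0) (μ := μ) (ν := ν) (ρ₂ := ρ₂) hρ₁)
    (isGood_paramMap hε hε' hμ hν hρ₁) hσ hm
  have hlam₁ : 1 ≤ max lam₀ (2 * ρ₃ / (ρ₁ * δ)) := hlam₀.trans (le_max_left _ _)
  refine ⟨δ, hδ, hδ2, max lam₀ (2 * ρ₃ / (ρ₁ * δ)), hlam₁, c, hc, ?_⟩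
  intro γ₁ γ₃ Z h1 h2 h3 h4 hZ lam hlam
  obtain ⟨hL, hR, hdir⟩ := mem_region_spec hε hlam₁ hZ hlam
  have hl : 0 < ‖lam‖ := by linarith
  have hlam0 : lam ≠ 0 := norm_pos_iff.1 hl
  have hlC : (‖lam‖ : ℂ) ≠ 0 := by exact_mod_cast hl.ne'
  refine ⟨hlam0, fun s hs z w hz hw => ?_⟩
  refine H (γ₁⁻¹ * μ) (((γ₁⁻¹ * ν : ℝ) : ℂ) + zetaLim Z) (lam / ‖lam‖) ?_ ‖lam‖ s
    ((le_max_left _ _).trans hL) hs _ z w ?_ ?_ hw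
  · refine ⟨(γ₁, zetaLim Z, lam / ‖lam‖), ⟨⟨h1, h2⟩, hR, ?_, hdir⟩, rfl⟩
    rw [norm_div, Complex.norm_real, norm_norm, div_self hl.ne']
  · exact norm_kappaOf_sub_le hρ₁ hδ hδ2 h1 h3 h4 Z hlam0 ((le_max_right _ _).trans hL) hz
  · rw [mul_div_cancel₀ _ hlC]
    exact hz

/-! ### Conversion of weights and conclusion -/

lemma norm_multiDeriv_le {d : ℕ} (κ : Fin d → ℕ) (f : EuclideanSpace ℝ (Fin d) → ℂ)
    (ξ : EuclideanSpace ℝ (Fin d)) :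
    ‖multiDeriv κ f ξ‖ ≤ ‖iteratedFDeriv ℝ (∑ j, κ j) f ξ‖ := by
  refine (ContinuousMultilinearMap.le_opNorm _ _).trans ?_
  simp

lemma sqrt_add_le_two_mul_sqrt {L : ℝ} (hL : 0 ≤ L) (x : ℝ) :
    √L + x ≤ 2 * √(L + x ^ 2) := by
  have h1 : √L ≤ √(L + x ^ 2) := Real.sqrt_le_sqrt (by nlinarith)
  have h2 : x ≤ √(L + x ^ 2) := Real.le_sqrt_of_sq_le (by linarith)
  linarith

/-- The scaling argument produces powers of √(L + x²), the theorem asks for √L + x; each of the 2 +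
n factors costs a 2. -/
lemma weight_le {L x : ℝ} (hL : 0 < L) (hx : 0 ≤ x) (n : ℕ) :
    (L + x) * (√L + x) ^ (2 + n) ≤
      2 ^ (2 + n) * ((L + √(L + x ^ 2)) * (L + x ^ 2)) * √(L + x ^ 2) ^ n := by
  have h1 := sqrt_add_le_two_mul_sqrt hL.le x
  have h2 : x ≤ √(L + x ^ 2) := Real.le_sqrt_of_sq_le (by linarith)
  have h3 : √(L + x ^ 2) ^ 2 = L + x ^ 2 := Real.sq_sqrt (by positivity)
  calc (L + x) * (√L + x) ^ (2 + n) ≤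
        (L + √(L + x ^ 2)) * (2 * √(L + x ^ 2)) ^ (2 + n) := by gcongr
    _ = 2 ^ (2 + n) * ((L + √(L + x ^ 2)) * √(L + x ^ 2) ^ 2) * √(L + x ^ 2) ^ n := by
      rw [mul_pow, pow_add (√(L + x ^ 2))]; ring
    _ = _ := by rw [h3]

end

theorem lemma3p10 (ε σ m μ ν ζ₀ ρ₁ ρ₂ ρ₃ : ℝ)
    (hε : 0 < ε) (hε' : ε < Real.pi / 2) (hσ : 0 < σ) (hm : 0 < m) (hμ : 0 < μ) (hν : 0 < ν)
    (hρ₁ : 0 < ρ₁) (hρ₂ : 0 < ρ₂) (hρ₃ : 0 < ρ₃) :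
    ∃ lam₀ : ℝ, 1 ≤ lam₀ ∧ ∃ c : ℝ, 0 < c ∧ ∀ N : ℕ, 2 ≤ N →
      -- `N(A,B)` is bounded below, and its inverse is a smooth function of `(λ, ξ')`
      (∀ (γ₁ γ₃ : ℝ) (Z : ZetaParam), ρ₁ ≤ γ₁ → γ₁ ≤ ρ₂ → 0 < γ₃ → γ₃ ≤ ρ₃ →
        Z.Admissible ε ζ₀ → ∀ lam ∈ Z.region ν ρ₃ ε lam₀,
        ∀ ξ : EuclideanSpace ℝ (Fin (N - 1)), ξ ≠ 0 →
          c * ((‖lam‖ + ‖ξ‖) * (√‖lam‖ + ‖ξ‖) ^ 2) ≤ ‖symbNAB σ m μ ν γ₁ γ₃ Z lam ξ‖ ∧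
          ContDiffAt ℝ ∞ (fun p : ℂ × EuclideanSpace ℝ (Fin (N - 1)) =>
            (symbNAB σ m μ ν γ₁ γ₃ Z p.1 p.2)⁻¹) (lam, ξ)) ∧
      -- the symbol estimate
      (∀ κ : Fin (N - 1) → ℕ, ∃ C : ℝ, 0 < C ∧
        ∀ (γ₁ γ₃ : ℝ) (Z : ZetaParam), ρ₁ ≤ γ₁ → γ₁ ≤ ρ₂ → 0 < γ₃ → γ₃ ≤ ρ₃ →
        Z.Admissible ε ζ₀ → ∀ lam ∈ Z.region ν ρ₃ ε lam₀,
        ∀ ξ : EuclideanSpace ℝ (Fin (N - 1)), ξ ≠ 0 → ∀ ℓ : ℕ, ℓ ≤ 1 →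
          ‖multiDeriv κ (fun η =>
              tauDeriv^[ℓ] (fun z => (symbNAB σ m μ ν γ₁ γ₃ Z z η)⁻¹) lam) ξ‖ ≤
            C * (‖lam‖ + ‖ξ‖)⁻¹ * ((√‖lam‖ + ‖ξ‖) ^ (2 + ∑ j, κ j))⁻¹) := by
  obtain ⟨δ, hδ, hδ2, lam₀, hlam₀, c, hc, H⟩ :=
    exists_lowerBoundNear ζ₀ ρ₂ ρ₃ hε hε' hσ hm hμ hν hρ₁
  -- The 4 is the factor 2² in `weight_le` with n = 0.
  refine ⟨lam₀, hlam₀, c / 4, by positivity, fun N _ => ⟨?_, fun κ => ?_⟩⟩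
  · intro γ₁ γ₃ Z h1 h2 h3 h4 hZ lam hlam ξ _
    obtain ⟨hlam0, H'⟩ := H γ₁ γ₃ Z h1 h2 h3 h4 hZ lam hlam
    have hl : 0 < ‖lam‖ := norm_pos_iff.2 hlam0
    have Hξ := H' (‖ξ‖ ^ 2) (by positivity)
    refine ⟨le_trans ?_ (Hξ.le_norm_symbNAB hlam0 hδ),
      Hξ.contDiffAt hlam0 hδ hδ2 (by positivity)⟩
    have hw := weight_le hl (norm_nonneg ξ) 0
    simp only [add_zero, pow_zero, mul_one] at hw
    nlinarith
  · obtain ⟨n, hn⟩ : ∃ n, n = ∑ j, κ j := ⟨_, rfl⟩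
    -- The Cauchy constant, then 2ⁿ from (2/r)ⁿ, then 2^(2 + n) from `weight_le`.
    refine ⟨n.factorial * (n.factorial * (1 / (c * δ)) * (2 / δ) ^ n) * 2 ^ n * 2 ^ (2 + n),
      by positivity, ?_⟩
    intro γ₁ γ₃ Z h1 h2 h3 h4 hZ lam hlam ξ _ ℓ hℓ
    obtain ⟨hlam0, H'⟩ := H γ₁ γ₃ Z h1 h2 h3 h4 hZ lam hlam
    have hl : 0 < ‖lam‖ := norm_pos_iff.2 hlam0
    have Hξ := H' (‖ξ‖ ^ 2) (by positivity)
    refine (norm_multiDeriv_le κ _ ξ).trans ?_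
    rw [← hn]
    refine (Hξ.norm_iteratedFDeriv_le hlam0 hδ hδ2 (by positivity) n hℓ).trans ?_
    have hw := weight_le hl (norm_nonneg ξ) n
    obtain ⟨W, hW⟩ : ∃ W, W = (‖lam‖ + ‖ξ‖) * (√‖lam‖ + ‖ξ‖) ^ (2 + n) := ⟨_, rfl⟩
    obtain ⟨P, hP⟩ : ∃ P, P = (‖lam‖ + √(‖lam‖ + ‖ξ‖ ^ 2)) * (‖lam‖ + ‖ξ‖ ^ 2) := ⟨_, rfl⟩
    obtain ⟨r, hr⟩ : ∃ r, r = √(‖lam‖ + ‖ξ‖ ^ 2) := ⟨_, rfl⟩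
    have hW0 : 0 < W := by rw [hW]; positivity
    have hP0 : 0 < P := by rw [hP]; positivity
    have hr0 : 0 < r := by rw [hr]; positivity
    rw [← hW, ← hP, ← hr] at hw
    rw [mul_assoc _ (‖lam‖ + ‖ξ‖)⁻¹, ← mul_inv, ← hW, ← hP, ← hr]
    have hkey : 1 / P * (1 / r) ^ n ≤ 2 ^ (2 + n) * W⁻¹ := by
      rw [← div_eq_mul_inv, div_pow, one_pow, div_mul_div_comm, one_mul,
        div_le_div_iff₀ (by positivity) hW0]
      linarith
    calc (n.factorial : ℝ) * (n.factorial * (1 / (c * P * δ)) * (2 / δ) ^ n) * (2 / r) ^ n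
        = n.factorial * (n.factorial * (1 / (c * δ)) * (2 / δ) ^ n) * 2 ^ n *
            (1 / P * (1 / r) ^ n) := by
          rw [div_pow 2 r, div_pow 1 r, one_pow]; field_simp
      _ ≤ n.factorial * (n.factorial * (1 / (c * δ)) * (2 / δ) ^ n) * 2 ^ n *
            (2 ^ (2 + n) * W⁻¹) := by gcongr
      _ = _ := by ring
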